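/- **Setting.** Let $\mathcal S$, $\mathcal D$, $\mathcal C$, $\mathcal T$ be finite sets of students, districts, schools and types. Each student $s$ has a home district $d(s)\in\mathcal D$ and a type $\tau(s)\in\mathcal T$; each school $c$ has a home district $d(c)\in\mathcal D$ and a capacity $q_c\in\mathbb Z_{\ge 0}$; $k_d$ is the number of students with home district $d$. Each student $s$ has a strict preference order $P_s$ over $\mathcal C\cup\{\emptyset\}$ in which $\emptyset$ (being unmatched) is ranked last; $R_s$ is the associated weak order. A contract $(s,c)$ matches student $s$ with school $c$ (and so with the district $d(c)$). A matching is a set of contracts; it is feasible if each student has at most one contract and each school $c$ has at most $q_c$ contracts. There is a feasible initial matching $\tilde X$ in which every student has exactly one contract; the school in it is the student's initial school. A distribution is a vector $\xi=(\xi_c^t)\in\mathbb Z_{\ge 0}^{\mathcal C\times\mathcal T}$; $\chi_{c,t}$ is the distribution with a single entry $1$ at $(c,t)$ and zeros elsewhere; the distribution $\xi(X)$ of a matching $X$ counts the type-$t$ students at school $c$ for all $(c,t)$. A policy goal is a set $\Xi$ of distributions; $X$ satisfies $\Xi$ if $\xi(X)\in\Xi$. Put $$\Xi^0=\Big\{\xi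 : \sum_{c,t}\xi_c^t=\sum_d k_d,\ \ \sum_t\xi_c^t\le q_c\ \text{for all } c\Big\}.$$ A set $\Xi$ of distributions is *M-convex* if, whenever $\xi,\tilde\xi\in\Xi$ and $\xi_c^t>\tilde\xi_c^t$ for some $(c,t)$, there is $(c',t')$ with $\xi_{c'}^{t'}<\tilde\xi_{c'}^{t'}$ such that $\xi-\chi_{c,t}+\chi_{c',t'}\in\Xi$ and $\tilde\xi+\chi_{c,t}-\chi_{c',t'}\in\Xi$. For floors $p_c^t$ and ceilings $q_c^t$ in $\mathbb Z_{\ge 0}$, the *combination of balanced-exchange and school-level diversity policies* is $$\Xi=\Big\{\xi : p_c^t\le\xi_c^t\le q_c^t\ \text{for all } c,t,\ \text{ and }\ \sum_t\sum_{c:\,d(c)=d}\xi_c^t=k_d\ \text{for all } d\Big\}.$$ **Properties.** A mechanism maps each profile $P=(P_s)_s$ to a feasible matching. It satisfies $\Xi$ if its outcome always does. It is *constrained efficient* if its outcome at each $P$ satisfies $\Xi$ and no feasible matching satisfying $\Xi$ is weakly preferred to it by all students and strictly by at least one. It is *individually rational* if each student always weakly prefers her outcome to her initial school. It is *strategy-proof*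 if no student can ever obtain a strictly preferred outcome by misreporting her preferences. **TTC.** Fix a strict master priority order of the students. For student $s$ of type $t$ with initial school $c_0$, the pair $(c_0,t)$ is her initial pair, and $\tilde P_s$ is a strict order on $\mathcal C\times\mathcal T$, determined by $P_s$, that ranks the pairs $(c,t)$ as $P_s$ ranks the schools $c$ and ranks $(c_0,t)$ above every pair whose type is not $t$ (it is otherwise arbitrary). At each pair, students with that initial pair have priority over all others, and ties are broken by the master order. At step $n$ let $X^n$ consist of the pairs assigned in earlier steps and of the initial pairs of the unassigned students. An unassigned student with initial pair $(c,t)$ is permissible to a pair $(c',t')$ if $\xi(X^n)+\chi_{c',t'}-\chi_{c,t}\in\Xi\cap\Xi^0$. A pair to which no unassigned student is permissible is removed for good; each remaining pair points to the highest-priority unassigned student permissible to it; each unassigned student points to the $\tilde P_s$-best remaining pair; all cycles are executed, that is, each student on a cycle is assigned the pair she points to and leaves. The algorithm stops when no student remains, and its outcome matches each student with the school of her assigned pair. **Corollary 5.** 1. For all floors and ceilings, $\Xi\cap\Xi^0$ is M-convex, where $\Xi$ is the combination of balanced-exchange and school-level diversity policies. (In general, the intersection of two M-convex sets need not be M-convex: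 there are finite sets of schools and types and two M-convex sets of distributions whose intersection is not M-convex.) 2. If the initial matching satisfies $\Xi$, then, for every master priority order, TTC always terminates and is a mechanism (its outcome is always a feasible matching) that satisfies $\Xi$, constrained efficiency, individual rationality and strategy-proofness. -/

import Mathlib

namespace SchoolChoice

/-- A strict linear order on `A`; `O.rel a b` reads "`a` is ranked strictly above `b`". -/
structure StrictOrder (A : Type*) where
  rel : A → A → Prop
  strict : IsStrictTotalOrder A rel

/-- A strict preference order of a student over all schools and the outside option `none` of being
unmatched, in which the outside option is the least preferred outcome. -/
structure StudentPref (C : Type*) extends StrictOrder (Option C) where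
  outside_least : ∀ c : C, rel (some c) none

/-- The weak order of a strict preference order. -/
def StudentPref.weak {C : Type*} (P : StudentPref C) (a b : Option C) : Prop :=
  P.rel a b ∨ a = b

/-- A matching is a set of contracts. A contract names a student and a school; the district of the
contract is the home district of the school. -/
abbrev Matching (S C : Type*) := Finset (S × C)

/-- A matching is feasible for students if every student has at most one contract. -/
def FeasibleForStudents {S C : Type*} (X : Matching S C) : Prop :=
  ∀ (s : S) (c c' : C), (s, c) ∈ X → (s, c') ∈ X → c = c'

open Classical in
/-- A matching is feasible for the capacities `q` if it is feasible for students and no school has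
more contracts than its capacity. -/
def Feasible {S C : Type*} (q : C → ℕ) (X : Matching S C) : Prop :=
  FeasibleForStudents X ∧ ∀ c : C, (X.filter fun x => x.2 = c).card ≤ q c

open Classical in
/-- The outcome of a student: her school, or `none` if she has no contract. It is used only for
matchings that are feasible for students, where the school is unique. -/
noncomputable def outcome {S C : Type*} (X : Matching S C) (s : S) : Option C :=
  if h : ∃ c, (s, c) ∈ X then some h.choose else none

/-- The components of a school choice problem other than the students' preferences: home districts
of students and schools, types, capacities, and a feasible initial matching in which every student
has exactly one contract. -/
structure Problem (S D C T : Type*) where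
  studentDistrict : S → D
  schoolDistrict : C → D
  type : S → T
  capacity : C → ℕ
  initial : Matching S C
  initial_feasible : Feasible capacity initial
  initial_unique : ∀ s : S, ∃! c : C, (s, c) ∈ initial

/-- A distribution: the number of students of each type at each school. -/
abbrev Distribution (C T : Type*) := C × T → ℕ

open Classical in
/-- The distribution with exactly one student, of type `v.2` at school `v.1`. -/
noncomputable def unit {C T : Type*} (v : C × T) : Distribution C T :=
  fun w => if w = v then 1 else 0

/-- M-convexity of a set of distributions. The subtractions are never truncated, since
`y v < x v` and `x w < y w`. -/
def MConvex {C T : Type*} (A : Set (Distribution C T)) : Prop :=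
  ∀ x ∈ A, ∀ y ∈ A, ∀ v : C × T, y v < x v →
    ∃ w : C × T, x w < y w ∧ x - unit v + unit w ∈ A ∧ y + unit v - unit w ∈ A

/-- A mechanism takes a profile of student preferences and produces a matching; that the matching
is feasible is the property `MechanismFeasible` below. -/
abbrev Mechanism (S C : Type*) := (S → StudentPref C) → Matching S C

namespace Problem

variable {S D C T : Type*}

/-- The initial school of a student. -/
noncomputable def initialSchool (E : Problem S D C T) (s : S) : C :=
  (E.initial_unique s).choose

open Classical in
/-- The distribution associated with a matching. -/
noncomputable def dist (E : Problem S D C T) (X : Matching S C) : Distribution C T :=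
  fun v => (X.filter fun x => x.2 = v.1 ∧ E.type x.1 = v.2).card

/-- A matching satisfies the policy goal `G` if its distribution is in `G`. -/
def Satisfies (E : Problem S D C T) (G : Set (Distribution C T)) (X : Matching S C) : Prop :=
  E.dist X ∈ G

open Classical in
/-- The number of students whose home district is `d`. -/
noncomputable def homeCount [Fintype S] (E : Problem S D C T) (d : D) : ℕ :=
  (Finset.univ.filter fun s => E.studentDistrict s = d).card

/-- The policy that every student is matched and no school exceeds its capacity. -/
def basePolicy [Fintype S] [Fintype D] [Fintype C] [Fintype T] (E : Problem S D C T) :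
    Set (Distribution C T) :=
  {x | ∑ c, ∑ t, x (c, t) = ∑ d, E.homeCount d ∧ ∀ c, ∑ t, x (c, t) ≤ E.capacity c}

open Classical in
/-- The combination of the balanced-exchange policy and the school-level diversity policy with
floors `floor c t` and ceilings `ceil c t`. -/
def combinedPolicy [Fintype S] [Fintype C] [Fintype T] (E : Problem S D C T)
    (floor ceil : C → T → ℕ) : Set (Distribution C T) :=
  {x | (∀ c t, floor c t ≤ x (c, t) ∧ x (c, t) ≤ ceil c t) ∧
    ∀ d, ∑ t, ∑ c with E.schoolDistrict c = d, x (c, t) = E.homeCount d}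

/-! ### Properties of matchings and mechanisms -/

/-- `X` Pareto dominates `Y` at the preference profile `P`. -/
def ParetoDominates (P : S → StudentPref C) (X Y : Matching S C) : Prop :=
  (∀ s, (P s).weak (outcome X s) (outcome Y s)) ∧ ∃ s, (P s).rel (outcome X s) (outcome Y s)

/-- Every matching that the mechanism produces is feasible. -/
def MechanismFeasible (E : Problem S D C T) (φ : Mechanism S C) : Prop :=
  ∀ P, Feasible E.capacity (φ P)

/-- Every matching that the mechanism produces satisfies the policy goal. -/
def SatisfiesPolicy (E : Problem S D C T) (G : Set (Distribution C T)) (φ : Mechanism S C) : Prop :=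
  ∀ P, E.Satisfies G (φ P)

/-- Every matching that the mechanism produces is feasible, satisfies the policy goal, and is not
Pareto dominated by any feasible matching that satisfies the policy goal. -/
def ConstrainedEfficient (E : Problem S D C T) (G : Set (Distribution C T))
    (φ : Mechanism S C) : Prop :=
  ∀ P, Feasible E.capacity (φ P) ∧ E.Satisfies G (φ P) ∧
    ¬ ∃ Y : Matching S C, Feasible E.capacity Y ∧ E.Satisfies G Y ∧ ParetoDominates P Y (φ P)

/-- Every student always weakly prefers her outcome to her initial school. -/
def IndividuallyRational (E : Problem S D C T) (φ : Mechanism S C) : Prop :=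
  ∀ (P : S → StudentPref C) (s : S), (P s).weak (outcome (φ P) s) (outcome E.initial s)

open Classical in
/-- No student can get a strictly better outcome by misreporting her preferences. -/
def StrategyProof (φ : Mechanism S C) : Prop :=
  ∀ (P : S → StudentPref C) (s : S) (P' : StudentPref C),
    ¬ (P s).rel (outcome (φ (Function.update P s P')) s) (outcome (φ P) s)

/-! ### The top trading cycles mechanism -/

/-- The initial school-type pair of a student. -/
noncomputable def initialPair (E : Problem S D C T) (s : S) : C × T :=
  (E.initialSchool s, E.type s)

/-- A rule that turns a preference of a student over schools into a preference over school-type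
pairs: pairs with her own type are ranked as their schools are, and her initial pair is ranked
above every pair with a different type. The rest of the order is arbitrary. -/
structure HypotheticalPreferences (E : Problem S D C T) where
  pref : S → StudentPref C → StrictOrder (C × T)
  own_type : ∀ (s : S) (P : StudentPref C) (c c' : C),
    (pref s P).rel (c, E.type s) (c', E.type s) ↔ P.rel (some c) (some c')
  other_type : ∀ (s : S) (P : StudentPref C) (c : C) (t : T), t ≠ E.type s →
    (pref s P).rel (E.initialPair s) (c, t)

/-- The priority of school-type pair `v`: students initially matched with `v` come before all other
students, and ties are broken by the master priority list. -/
def HigherPriority (E : Problem S D C T) (master : StrictOrder S) (v : C × T) (s s' : S) : Prop :=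
  (E.initialPair s = v ∧ E.initialPair s' ≠ v) ∨
    ((E.initialPair s = v ↔ E.initialPair s' = v) ∧ master.rel s s')

/-- A state of the algorithm: the unassigned students, the remaining school-type pairs, and the
matching formed by the assignments made so far and the initial pairs of unassigned students. -/
structure TTCState (S C T : Type*) where
  students : Finset S
  pairs : Finset (C × T)
  matching : S → C × T

open Classical in
/-- The distribution of a matching of students with school-type pairs. -/
noncomputable def pairDist [Fintype S] (X : S → C × T) : Distribution C T :=
  fun v => (Finset.univ.filter fun s => X s = v).card

section Algorithm

variable [Fintype S] [Fintype D] [Fintype C] [Fintype T]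

/-- Student `s` is permissible to the pair `v` at `X`: moving her from her initial pair to `v`
keeps the policy goal `G` and keeps all students matched within the capacities. The subtraction is
never truncated for a student who still holds her initial pair at `X`. -/
def Permissible (E : Problem S D C T) (G : Set (Distribution C T)) (X : S → C × T)
    (v : C × T) (s : S) : Prop :=
  pairDist X + unit v - unit (E.initialPair s) ∈ G ∩ E.basePolicy

open Classical in
/-- The pairs left after removing those to which no unassigned student is permissible. -/
noncomputable def remainingPairs (E : Problem S D C T) (G : Set (Distribution C T))
    (st : TTCState S C T) : Finset (C × T) :=
  st.pairs.filter fun v => ∃ s ∈ st.students, E.Permissible G st.matching v s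

/-- The remaining pair `v` points to `s`: among the unassigned permissible students, `s` has the
highest priority. -/
def PairPointsTo (E : Problem S D C T) (G : Set (Distribution C T)) (master : StrictOrder S)
    (st : TTCState S C T) (v : C × T) (s : S) : Prop :=
  v ∈ E.remainingPairs G st ∧ s ∈ st.students ∧ E.Permissible G st.matching v s ∧
    ∀ s' ∈ st.students, E.Permissible G st.matching v s' → s' ≠ s → E.HigherPriority master v s s'

/-- The unassigned student `s` points to `v`: among the remaining pairs, `v` is the best one for the
order `Q s`. -/
def StudentPointsTo (E : Problem S D C T) (G : Set (Distribution C T))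
    (Q : S → StrictOrder (C × T)) (st : TTCState S C T) (s : S) (v : C × T) : Prop :=
  s ∈ st.students ∧ v ∈ E.remainingPairs G st ∧
    ∀ v' ∈ E.remainingPairs G st, v' ≠ v → (Q s).rel v v'

/-- Student `s` points to a pair that points to student `s'`. -/
def Follows (E : Problem S D C T) (G : Set (Distribution C T)) (master : StrictOrder S)
    (Q : S → StrictOrder (C × T)) (st : TTCState S C T) (s s' : S) : Prop :=
  ∃ v, E.StudentPointsTo G Q st s v ∧ E.PairPointsTo G master st v s'

/-- Student `s` is part of a cycle of the pointing graph. -/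
def OnCycle (E : Problem S D C T) (G : Set (Distribution C T)) (master : StrictOrder S)
    (Q : S → StrictOrder (C × T)) (st : TTCState S C T) (s : S) : Prop :=
  Relation.TransGen (E.Follows G master Q st) s s

open Classical in
/-- One step: pairs without permissible students are removed, all cycles are executed, and the
students on them are assigned the pairs they point to and leave. -/
noncomputable def ttcStep (E : Problem S D C T) (G : Set (Distribution C T))
    (master : StrictOrder S) (Q : S → StrictOrder (C × T)) (st : TTCState S C T) :
    TTCState S C T where
  students := st.students.filter fun s => ¬ E.OnCycle G master Q st s
  pairs := E.remainingPairs G st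
  matching s :=
    if h : ∃ v, E.OnCycle G master Q st s ∧ E.StudentPointsTo G Q st s v then h.choose
    else st.matching s

/-- The state after `n` steps, starting from the initial matching. -/
noncomputable def ttcState (E : Problem S D C T) (G : Set (Distribution C T))
    (master : StrictOrder S) (Q : S → StrictOrder (C × T)) : ℕ → TTCState S C T
  | 0 => { students := Finset.univ, pairs := Finset.univ, matching := E.initialPair }
  | n + 1 => E.ttcStep G master Q (E.ttcState G master Q n)

/-- The algorithm terminates at every preference profile: after some step no student remains. -/
def TTCTerminates (E : Problem S D C T) (G : Set (Distribution C T)) (master : StrictOrder S)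
    (H : E.HypotheticalPreferences) : Prop :=
  ∀ P : S → StudentPref C, ∃ n, (E.ttcState G master (fun s => H.pref s (P s)) n).students = ∅

open Classical in
/-- The top trading cycles mechanism for the policy goal `G`: the matching of students with schools
induced by the state of the algorithm at the first step after which no student remains. -/
noncomputable def ttc (E : Problem S D C T) (G : Set (Distribution C T)) (master : StrictOrder S)
    (H : E.HypotheticalPreferences) : Mechanism S C :=
  fun P =>
    let Q : S → StrictOrder (C × T) := fun s => H.pref s (P s)
    let n : ℕ := sInf {n | (E.ttcState G master Q n).students = ∅}
    Finset.univ.filter fun x : S × C => ((E.ttcState G master Q n).matching x.1).1 = x.2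

end Algorithm

end Problem

end SchoolChoice

/-!
The constraints of the combined policy, together with the capacities, are bounds on a laminar
family: single pairs, schools, and districts (with equality). Two consequences are used.

*M-convexity.* A surplus at a pair is exchanged against a deficit in the same school if there is
one; otherwise the school has a surplus as a whole, and the deficit is found at another school of
the district (`mConvex_feasiblePolicy`). M-convexity is not stable under intersection: row sums and
column sums of `2 × 2` matrices give a counterexample.

*Local form of permissibility.* Moving a student to another pair is possible exactly if the new pair
is below its ceiling, the old one above its floor, both lie in one district, and either both lie in
one school or the new school has a free seat (`permissible_iff`). A pair that is not owned by a
permissible student therefore points along the master order to the first student who can be spared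
in its school (if the school is full) or in its whole district (if not), so that many pairs agree on
the student to whom they point (`PairPointsTo.eq_of_permissible`). This gives the two facts on which
the analysis of the algorithm rests. Executing all cycles at once brings each constrained number of
students closer to its bound by at most one, and only where there is slack
(`Valid.pairDist_ttcStep_mem`). And a pair goes on pointing to a student until she leaves
(`Valid.pairPointsTo_ttcStep`).

Individual rationality and termination hold because the initial pair of an unassigned student is
never removed. Efficiency follows from M-convexity: if an unassigned student could get a removed
pair in some distribution of the policy, an exchange would make an unassigned student permissible to
this pair (`ne_of_not_permissible`). Strategy-proofness is the usual argument for trading cycles: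
the run does not depend on the report of a student until she is on a cycle, and a path from a pair
to her persists until she leaves, so all that she could get early she can also get later
(`not_rel_ttcAssignment`).
-/

namespace SchoolChoice

open scoped Classical

/-! ### Strict orders -/

section Orders

variable {A : Type*}

theorem StrictOrder.asymm (O : StrictOrder A) {a b : A} (h : O.rel a b) : ¬ O.rel b a :=
  haveI := O.strict
  asymm_of O.rel h

theorem StrictOrder.irrefl (O : StrictOrder A) (a : A) : ¬ O.rel a a :=
  fun h => O.asymm h h

theorem StrictOrder.trichotomous (O : StrictOrder A) (a b : A) : O.rel a b ∨ a = b ∨ O.rel b a :=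
  haveI := O.strict
  trichotomous_of O.rel a b

theorem StrictOrder.trans (O : StrictOrder A) {a b c : A} (h : O.rel a b) (h' : O.rel b c) :
    O.rel a c :=
  haveI := O.strict
  trans_of O.rel h h'

/-- A nonempty set of alternatives from a finite type has a best element. -/
theorem StrictOrder.exists_best [Finite A] (O : StrictOrder A) (p : A → Prop) (h : ∃ a, p a) :
    ∃ a, p a ∧ ∀ b, p b → b ≠ a → O.rel a b := by
  have := O.strict
  have wf : WellFounded O.rel := Finite.wellFounded_of_trans_of_irrefl O.rel
  obtain ⟨a, ha, hmin⟩ := wf.has_min {a | p a} h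
  refine ⟨a, ha, fun b hb hne => ?_⟩
  rcases O.trichotomous a b with h | h | h
  · exact h
  · exact absurd h.symm hne
  · exact absurd h (hmin b hb)

end Orders

/-! ### Exchanges in distributions -/

section Sums

variable {C T : Type*}

theorem unit_self (v : C × T) : unit v v = 1 := by simp [unit]

theorem unit_of_ne {v w : C × T} (h : w ≠ v) : unit v w = 0 := by simp [unit, h]

theorem sum_unit (W : Finset (C × T)) (v : C × T) :
    ∑ u ∈ W, unit v u = if v ∈ W then 1 else 0 := by
  simp [unit]

theorem add_unit_sub_unit_add {x : Distribution C T} {v w : C × T} (hw : 1 ≤ x w) :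
    x + unit v - unit w + unit w = x + unit v := by
  funext u
  by_cases hu : u = w
  · subst hu
    simp only [Pi.add_apply, Pi.sub_apply, unit_self]
    omega
  · simp [unit_of_ne hu]

theorem sub_unit_add_unit {x : Distribution C T} {v w : C × T} (hw : 1 ≤ x w) :
    x - unit w + unit v = x + unit v - unit w := by
  funext u
  by_cases hu : u = w
  · subst hu
    simp only [Pi.add_apply, Pi.sub_apply, unit_self]
    omega
  · simp [unit_of_ne hu]

theorem sum_exchange {x : Distribution C T} {v w : C × T} (hw : 1 ≤ x w) (W : Finset (C × T)) :
    ∑ u ∈ W, (x + unit v - unit w) u + (if w ∈ W then 1 else 0) =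
      ∑ u ∈ W, x u + if v ∈ W then 1 else 0 := by
  rw [← sum_unit, ← sum_unit, ← Finset.sum_add_distrib, ← Finset.sum_add_distrib]
  exact Finset.sum_congr rfl fun u _ => congrFun (add_unit_sub_unit_add hw) u

theorem apply_exchange {x : Distribution C T} {v w : C × T} (hw : 1 ≤ x w) (u : C × T) :
    (x + unit v - unit w) u + unit w u = x u + unit v u :=
  congrFun (add_unit_sub_unit_add hw) u

variable [Fintype C] [Fintype T]

/-- The distributions with exactly one student in every fibre of `f` form an M-convex set: an
exchange can always be made inside a fibre. -/
theorem mConvex_fiberSum {K : Type*} [DecidableEq K] (f : C × T → K) :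
    MConvex {x : Distribution C T | ∀ k, ∑ u with f u = k, x u = 1} := by
  intro x hx y hy v hv
  obtain ⟨w, hfw, hw⟩ : ∃ w, f w = f v ∧ x w < y w := by
    by_contra! hcon
    have : ∑ u with f u = f v, y u < ∑ u with f u = f v, x u :=
      Finset.sum_lt_sum (fun u hu => hcon u (by simpa using hu)) ⟨v, by simp, hv⟩
    have h1 := hx (f v)
    have h2 := hy (f v)
    omega
  refine ⟨w, hw, fun k => ?_, fun k => ?_⟩
  · rw [sub_unit_add_unit (by omega)]
    have h := sum_exchange (v := w) (w := v) (x := x) (by omega) (Finset.univ.filter (f · = k))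
    rw [hx k] at h
    simp only [Finset.mem_filter, Finset.mem_univ, true_and, hfw] at h
    omega
  · have h := sum_exchange (v := v) (w := w) (x := y) (by omega) (Finset.univ.filter (f · = k))
    rw [hy k] at h
    simp only [Finset.mem_filter, Finset.mem_univ, true_and, hfw] at h
    omega

end Sums

/-- M-convexity is not preserved by intersections: among the `2 × 2` matrices, both the row sums
and the column sums equal to one define M-convex sets, but the common elements are the two
permutation matrices, which are two exchanges apart. -/
theorem exists_mConvex_inter_not_mConvex :
    ∃ (m n : ℕ) (A B : Set (Distribution (Fin m) (Fin n))),
      MConvex A ∧ MConvex B ∧ ¬ MConvex (A ∩ B) := by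
  refine ⟨2, 2, _, _, mConvex_fiberSum Prod.fst, mConvex_fiberSum Prod.snd, fun h => ?_⟩
  have key : ∀ z : Distribution (Fin 2) (Fin 2),
      z ∈ {x : Distribution (Fin 2) (Fin 2) | ∀ k, ∑ u with u.1 = k, x u = 1} ∩
        {x : Distribution (Fin 2) (Fin 2) | ∀ k, ∑ u with u.2 = k, x u = 1} ↔
      (z (0, 0) + z (0, 1) = 1 ∧ z (1, 0) + z (1, 1) = 1) ∧
        z (0, 0) + z (1, 0) = 1 ∧ z (0, 1) + z (1, 1) = 1 := by
    intro z
    simp [Fin.forall_fin_two, Finset.sum_filter, Fintype.sum_prod_type]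
  have hI := (key fun u => if u.1 = u.2 then 1 else 0).2 (by simp)
  have hJ := (key fun u => if u.1 = u.2 then 0 else 1).2 (by simp)
  obtain ⟨w, hw, hmem, -⟩ := h _ hI _ hJ (0, 0) (by simp)
  rw [key] at hmem
  obtain ⟨i, j⟩ := w
  fin_cases i <;> fin_cases j <;> simp [unit] at hw hmem

/-! ### The policy -/

namespace Problem

variable {S D C T : Type*} [Fintype C] [Fintype T]
variable {E : Problem S D C T} {floor ceil : C → T → ℕ}

theorem sum_district_eq (E : Problem S D C T) (x : Distribution C T) (d : D) :
    ∑ t, ∑ c with E.schoolDistrict c = d, x (c, t) =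
      ∑ u with E.schoolDistrict u.1 = d, x u := by
  simp only [Finset.sum_filter]
  rw [Fintype.sum_prod_type, Finset.sum_comm]

theorem sum_school_eq (x : Distribution C T) (c : C) :
    ∑ t, x (c, t) = ∑ u with u.1 = c, x u := by
  simp only [Finset.sum_filter]
  rw [Fintype.sum_prod_type, Finset.sum_comm]
  simp

variable [Fintype S] [Fintype D]

/-- The distributions that satisfy the combined policy and match all students within the
capacities. -/
abbrev feasiblePolicy (E : Problem S D C T) (floor ceil : C → T → ℕ) : Set (Distribution C T) :=
  E.combinedPolicy floor ceil ∩ E.basePolicy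

/-- The requirement on the total number of students is implied by those on the districts. The
remaining constraints live on a laminar family: pairs, schools, districts. -/
theorem mem_feasiblePolicy_iff {x : Distribution C T} :
    x ∈ E.feasiblePolicy floor ceil ↔
      (∀ u, floor u.1 u.2 ≤ x u ∧ x u ≤ ceil u.1 u.2) ∧
      (∀ d, ∑ u with E.schoolDistrict u.1 = d, x u = E.homeCount d) ∧
      ∀ c, ∑ u with u.1 = c, x u ≤ E.capacity c := by
  simp only [feasiblePolicy, combinedPolicy, basePolicy, Set.mem_inter_iff, Set.mem_ofPred_eq,
    sum_district_eq, sum_school_eq, Prod.forall]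
  constructor
  · rintro ⟨⟨h1, h2⟩, -, h3⟩
    exact ⟨h1, h2, h3⟩
  · rintro ⟨h1, h2, h3⟩
    refine ⟨⟨h1, h2⟩, ?_, h3⟩
    rw [← Finset.sum_congr rfl fun d _ => h2 d, Finset.sum_fiberwise (g := fun u : C × T => u.1),
      Finset.sum_fiberwise (g := fun u : C × T => E.schoolDistrict u.1)]

/-- When moving one unit from the pair `w` to the pair `v` keeps a distribution in the policy. -/
theorem add_sub_mem_feasiblePolicy_iff {x : Distribution C T} (hx : x ∈ E.feasiblePolicy floor ceil)
    {v w : C × T} (hw : 1 ≤ x w) (hvw : v ≠ w) :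
    x + unit v - unit w ∈ E.feasiblePolicy floor ceil ↔
      x v < ceil v.1 v.2 ∧ floor w.1 w.2 < x w ∧
        E.schoolDistrict v.1 = E.schoolDistrict w.1 ∧
        (v.1 = w.1 ∨ ∑ u with u.1 = v.1, x u < E.capacity v.1) := by
  rw [mem_feasiblePolicy_iff] at hx ⊢
  obtain ⟨h1, h2, h3⟩ := hx
  have hv' := apply_exchange (v := v) hw v
  have hw' := apply_exchange (v := v) hw w
  rw [unit_self, unit_of_ne hvw] at hv'
  rw [unit_self, unit_of_ne hvw.symm] at hw'
  constructor
  · rintro ⟨g1, g2, g3⟩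
    refine ⟨?_, ?_, ?_, ?_⟩
    · have := (g1 v).2
      omega
    · have := (g1 w).1
      omega
    · have h := sum_exchange (v := v) hw
        (Finset.univ.filter (E.schoolDistrict ·.1 = E.schoolDistrict v.1))
      rw [h2, g2] at h
      simp only [Finset.mem_filter, Finset.mem_univ, true_and, if_true] at h
      by_contra hne
      rw [if_neg (fun h => hne h.symm)] at h
      omega
    · refine or_iff_not_imp_left.2 fun hne => ?_
      have h := sum_exchange (v := v) hw (Finset.univ.filter (·.1 = v.1))
      simp only [Finset.mem_filter, Finset.mem_univ, true_and, if_true] at h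
      rw [if_neg (fun h => hne h.symm)] at h
      have := g3 v.1
      omega
  · rintro ⟨g1, g2, g3, g4⟩
    refine ⟨fun u => ?_, fun d => ?_, fun c => ?_⟩
    · have hu := apply_exchange (v := v) hw u
      have h1u := h1 u
      by_cases huv : u = v
      · subst huv
        omega
      by_cases huw : u = w
      · subst huw
        omega
      rw [unit_of_ne huv, unit_of_ne huw] at hu
      omega
    · have h := sum_exchange (v := v) hw (Finset.univ.filter (E.schoolDistrict ·.1 = d))
      rw [h2] at h
      simp only [Finset.mem_filter, Finset.mem_univ, true_and, g3] at h
      omega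
    · have h := sum_exchange (v := v) hw (Finset.univ.filter (·.1 = c))
      simp only [Finset.mem_filter, Finset.mem_univ, true_and] at h
      have h3c := h3 c
      rcases g4 with g4 | g4
      · rw [g4] at h
        omega
      · by_cases hc : v.1 = c
        · subst hc
          split_ifs at h <;> omega
        · rw [if_neg hc] at h
          split_ifs at h <;> omega

/-- The exchange partner of a pair is found in the same school if possible. Otherwise the first
distribution has more students at that school than the second one, and the partner is found at
another school of the district, where the first distribution has fewer students. -/
theorem mConvex_feasiblePolicy : MConvex (E.feasiblePolicy floor ceil) := by
  intro x hx y hy v hv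
  obtain ⟨hx1, hx2, hx3⟩ := mem_feasiblePolicy_iff.1 hx
  obtain ⟨hy1, hy2, hy3⟩ := mem_feasiblePolicy_iff.1 hy
  suffices h : ∃ w, x w < y w ∧ E.schoolDistrict w.1 = E.schoolDistrict v.1 ∧
      (w.1 = v.1 ∨ ∑ u with u.1 = w.1, x u < E.capacity w.1 ∧
        ∑ u with u.1 = v.1, y u < E.capacity v.1) by
    obtain ⟨w, hw, hd, hc⟩ := h
    have hne : w ≠ v := by
      rintro rfl
      omega
    refine ⟨w, hw, ?_, ?_⟩
    · rw [sub_unit_add_unit (by omega), add_sub_mem_feasiblePolicy_iff hx (by omega) hne]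
      exact ⟨hw.trans_le (hy1 w).2, (hy1 v).1.trans_lt hv, hd, hc.imp_right And.left⟩
    · rw [add_sub_mem_feasiblePolicy_iff hy (by omega) hne.symm]
      exact ⟨hv.trans_le (hx1 v).2, (hx1 w).1.trans_lt hw, hd.symm, hc.imp Eq.symm And.right⟩
  by_cases hsame : ∃ w, x w < y w ∧ w.1 = v.1
  · obtain ⟨w, hw, hc⟩ := hsame
    exact ⟨w, hw, by rw [hc], Or.inl hc⟩
  push Not at hsame
  have hv1 : ∑ u with u.1 = v.1, y u < ∑ u with u.1 = v.1, x u :=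
    Finset.sum_lt_sum
      (fun u hu => not_lt.1 fun hlt => hsame u hlt (by simpa using hu)) ⟨v, by simp, hv⟩
  have hfib : ∀ z : Distribution C T,
      ∑ c with E.schoolDistrict c = E.schoolDistrict v.1, ∑ u with u.1 = c, z u =
        ∑ u with E.schoolDistrict u.1 = E.schoolDistrict v.1, z u := by
    intro z
    simp_rw [← sum_school_eq, Finset.sum_filter]
    rw [Fintype.sum_prod_type]
    exact Finset.sum_congr rfl fun c _ => by split_ifs <;> simp
  obtain ⟨c, hcd, hc⟩ : ∃ c, E.schoolDistrict c = E.schoolDistrict v.1 ∧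
      ∑ u with u.1 = c, x u < ∑ u with u.1 = c, y u := by
    by_contra! hcon
    have : ∑ c with E.schoolDistrict c = E.schoolDistrict v.1, ∑ u with u.1 = c, y u <
        ∑ c with E.schoolDistrict c = E.schoolDistrict v.1, ∑ u with u.1 = c, x u :=
      Finset.sum_lt_sum (fun c hc => hcon c (by simpa using hc)) ⟨v.1, by simp, hv1⟩
    rw [hfib, hfib, hx2, hy2] at this
    exact lt_irrefl _ this
  obtain ⟨w, hw, hlt⟩ := Finset.exists_lt_of_sum_lt hc
  obtain rfl : w.1 = c := by simpa using hw
  exact ⟨w, hlt, hcd, Or.inr ⟨hc.trans_le (hy3 _), hv1.trans_le (hx3 _)⟩⟩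

end Problem

/-! ### Counting students -/

section Counting

variable {S C T : Type*} [Fintype S]

theorem card_filter_le_of_imp {p q : S → Prop} [DecidablePred p] [DecidablePred q]
    (h : ∀ s, p s → q s) :
    (Finset.univ.filter p).card ≤ (Finset.univ.filter q).card :=
  Finset.card_le_card (Finset.monotone_filter_right _ fun s _ => h s)

theorem card_filter_le_add_one {p q : S → Prop} [DecidablePred p] [DecidablePred q]
    (s₀ : S) (h : ∀ s, s ≠ s₀ → p s → q s) :
    (Finset.univ.filter p).card ≤ (Finset.univ.filter q).card + 1 := by
  refine (Finset.card_le_card fun s hs => ?_).trans (Finset.card_insert_le s₀ _)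
  by_cases hne : s = s₀
  · simp [hne]
  · simp only [Finset.mem_insert, Finset.mem_filter, Finset.mem_univ, true_and] at hs ⊢
    exact Or.inr (h s hne hs)

namespace Problem

theorem one_le_pairDist (X : S → C × T) (s : S) : 1 ≤ pairDist X (X s) :=
  Finset.card_pos.2 ⟨s, by simp⟩

theorem pairDist_le_of_imp {X Y : S → C × T} {v : C × T} (h : ∀ s, X s = v → Y s = v) :
    pairDist X v ≤ pairDist Y v :=
  card_filter_le_of_imp h

theorem pairDist_le_add_one {X Y : S → C × T} {v : C × T} (s₀ : S)
    (h : ∀ s, s ≠ s₀ → X s = v → Y s = v) : pairDist X v ≤ pairDist Y v + 1 :=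
  card_filter_le_add_one s₀ h

theorem pairDist_comp_equiv (X : S → C × T) (e : S ≃ S) : pairDist (X ∘ e) = pairDist X := by
  funext v
  refine Finset.card_bij (fun s _ => e s) (fun s hs => ?_) (fun _ _ _ _ h => e.injective h)
    fun s hs => ⟨e.symm s, ?_, by simp⟩
  · simpa using hs
  · simpa using hs

theorem sum_pairDist [Fintype C] [Fintype T] (X : S → C × T) (p : C × T → Prop) :
    ∑ u with p u, pairDist X u = (Finset.univ.filter fun s => p (X s)).card := by
  rw [Finset.card_eq_sum_card_fiberwise (f := X) (t := Finset.univ.filter p)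
    fun s hs => by simpa using hs]
  refine Finset.sum_congr rfl fun u hu => ?_
  rw [Finset.filter_filter]
  refine congrArg Finset.card (Finset.filter_congr fun s _ => ?_)
  constructor
  · rintro rfl
    exact ⟨by simpa using hu, rfl⟩
  · exact And.right

end Problem

end Counting

/-! ### Priorities, permissibility and pointing -/

namespace Problem

variable {S D C T : Type*} {E : Problem S D C T} {master : StrictOrder S}

theorem HigherPriority.asymm {v : C × T} {s s' : S} (h : E.HigherPriority master v s s') :
    ¬ E.HigherPriority master v s' s := by
  intro h'
  rcases h with ⟨h1, h2⟩ | ⟨h1, h2⟩ <;> rcases h' with ⟨g1, g2⟩ | ⟨g1, g2⟩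
  · exact h2 g1
  · exact h2 (g1.2 h1)
  · exact g2 (h1.2 g1)
  · exact master.asymm h2 g2

theorem higherPriority_trichotomous (v : C × T) (s s' : S) :
    E.HigherPriority master v s s' ∨ s = s' ∨ E.HigherPriority master v s' s := by
  unfold HigherPriority
  rcases master.trichotomous s s' with h | h | h <;> tauto

theorem HigherPriority.trans {v : C × T} {s s' s'' : S} (h : E.HigherPriority master v s s')
    (h' : E.HigherPriority master v s' s'') : E.HigherPriority master v s s'' := by
  rcases h with ⟨h1, h2⟩ | ⟨h1, h2⟩ <;> rcases h' with ⟨g1, g2⟩ | ⟨g1, g2⟩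
  · exact absurd g1 h2
  · exact Or.inl ⟨h1, fun h => h2 (g1.2 h)⟩
  · exact Or.inl ⟨h1.2 g1, g2⟩
  · exact Or.inr ⟨h1.trans g1, master.trans h2 g2⟩

/-- The priority order at a pair. -/
def priorityOrder (E : Problem S D C T) (master : StrictOrder S) (v : C × T) : StrictOrder S where
  rel := E.HigherPriority master v
  strict :=
    { trichotomous := fun a b h h' =>
        ((higherPriority_trichotomous v a b).resolve_left h).resolve_right h'
      irrefl := fun _ h => h.asymm h
      trans := fun _ _ _ h h' => h.trans h' }

variable [Fintype S] [Fintype D] [Fintype C] [Fintype T]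
variable {floor ceil : C → T → ℕ}

theorem mem_feasiblePolicy_pairDist_iff {X : S → C × T} :
    pairDist X ∈ E.feasiblePolicy floor ceil ↔
      (∀ u, floor u.1 u.2 ≤ pairDist X u ∧ pairDist X u ≤ ceil u.1 u.2) ∧
      (∀ d, (Finset.univ.filter fun s => E.schoolDistrict (X s).1 = d).card = E.homeCount d) ∧
      ∀ c, (Finset.univ.filter fun s => (X s).1 = c).card ≤ E.capacity c := by
  simp only [mem_feasiblePolicy_iff, sum_pairDist]

/-- A student is permissible to her initial pair, and to any other pair `v` exactly if: `v` is
below its ceiling, her initial pair is above its floor, both are in one district, and either both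
are in one school or the school of `v` has a free seat. -/
theorem permissible_iff {X : S → C × T} (hX : pairDist X ∈ E.feasiblePolicy floor ceil)
    {v : C × T} {s : S} (hs : X s = E.initialPair s) :
    E.Permissible (E.combinedPolicy floor ceil) X v s ↔ v = E.initialPair s ∨
      (pairDist X v < ceil v.1 v.2 ∧
        floor (E.initialPair s).1 (E.initialPair s).2 < pairDist X (E.initialPair s) ∧
        E.schoolDistrict v.1 = E.schoolDistrict (E.initialPair s).1 ∧
        (v.1 = (E.initialPair s).1 ∨
          (Finset.univ.filter fun s' => (X s').1 = v.1).card < E.capacity v.1)) := by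
  have h1 : 1 ≤ pairDist X (E.initialPair s) := hs ▸ one_le_pairDist X s
  by_cases hv : v = E.initialPair s
  · refine iff_of_true ?_ (Or.inl hv)
    unfold Permissible
    rwa [hv, add_tsub_cancel_right]
  · rw [or_iff_right hv]
    unfold Permissible
    rw [add_sub_mem_feasiblePolicy_iff hX h1 hv, sum_pairDist]

variable {G : Set (Distribution C T)} {Q : S → StrictOrder (C × T)} {st : TTCState S C T}

theorem PairPointsTo.unique {v : C × T} {s s' : S} (h : E.PairPointsTo G master st v s)
    (h' : E.PairPointsTo G master st v s') : s = s' := by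
  by_contra hne
  exact (h.2.2.2 s' h'.2.1 h'.2.2.1 (Ne.symm hne)).asymm (h'.2.2.2 s h.2.1 h.2.2.1 hne)

theorem StudentPointsTo.unique {s : S} {v v' : C × T} (h : E.StudentPointsTo G Q st s v)
    (h' : E.StudentPointsTo G Q st s v') : v = v' := by
  by_contra hne
  exact (Q s).asymm (h.2.2 v' h'.2.1 (Ne.symm hne)) (h'.2.2 v h.2.1 hne)

/-- If a pair points to a student who does not own it, then no permissible student owns it, and the
pointing follows the master order. -/
theorem PairPointsTo.master_rel {v : C × T} {s s' : S} (h : E.PairPointsTo G master st v s)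
    (hv : v ≠ E.initialPair s) (hs' : s' ∈ st.students)
    (hp : E.Permissible G st.matching v s') (hne : s' ≠ s) :
    master.rel s s' ∧ v ≠ E.initialPair s' := by
  rcases h.2.2.2 s' hs' hp hne with ⟨h1, -⟩ | ⟨h1, h2⟩
  · exact absurd h1.symm hv
  · exact ⟨h2, fun h3 => hv (h1.2 h3.symm).symm⟩

/-- Two students pointed to by pairs that they do not own coincide as soon as each of them is
permissible to the pair that points to the other. -/
theorem PairPointsTo.eq_of_permissible {v v' : C × T} {s s' : S}
    (h : E.PairPointsTo G master st v s) (hv : v ≠ E.initialPair s)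
    (h' : E.PairPointsTo G master st v' s') (hv' : v' ≠ E.initialPair s')
    (hp : E.Permissible G st.matching v s') (hp' : E.Permissible G st.matching v' s) : s = s' := by
  by_contra hne
  exact master.asymm (h.master_rel hv h'.2.1 hp (Ne.symm hne)).1
    (h'.master_rel hv' h.2.1 hp' hne).1

theorem exists_pairPointsTo {v : C × T} (hv : v ∈ E.remainingPairs G st) :
    ∃ s, E.PairPointsTo G master st v s := by
  have hv' := (Finset.mem_filter.1 hv).2
  obtain ⟨s, ⟨hs, hp⟩, hbest⟩ := (E.priorityOrder master v).exists_best
    (fun s => s ∈ st.students ∧ E.Permissible G st.matching v s) hv'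
  exact ⟨s, hv, hs, hp, fun s' hs' hp' hne => hbest s' ⟨hs', hp'⟩ hne⟩

theorem exists_studentPointsTo {s : S} (hs : s ∈ st.students)
    (hne : ∃ v, v ∈ E.remainingPairs G st) : ∃ v, E.StudentPointsTo G Q st s v := by
  obtain ⟨v, hv, hbest⟩ := (Q s).exists_best (· ∈ E.remainingPairs G st) hne
  exact ⟨v, hs, hv, hbest⟩

/-! ### Cycles of the pointing graph -/

theorem Follows.unique {s a b : S} (ha : E.Follows G master Q st s a)
    (hb : E.Follows G master Q st s b) : a = b := by
  obtain ⟨v, hv, ha⟩ := ha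
  obtain ⟨v', hv', hb⟩ := hb
  obtain rfl := hv.unique hv'
  exact ha.unique hb

theorem OnCycle.exists_follows {s : S} (h : E.OnCycle G master Q st s) :
    ∃ a, E.Follows G master Q st s a := by
  obtain ⟨a, ha, -⟩ := Relation.TransGen.head'_iff.1 h
  exact ⟨a, ha⟩

theorem OnCycle.mem_students {s : S} (h : E.OnCycle G master Q st s) : s ∈ st.students := by
  obtain ⟨a, v, hv, -⟩ := h.exists_follows
  exact hv.1

theorem OnCycle.of_follows {s a : S} (h : E.OnCycle G master Q st s)
    (ha : E.Follows G master Q st s a) : E.OnCycle G master Q st a := by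
  obtain ⟨b, hb, hbs⟩ := Relation.TransGen.head'_iff.1 h
  obtain rfl := ha.unique hb
  exact Relation.TransGen.tail' hbs ha

theorem OnCycle.of_reflTransGen {s a : S} (h : E.OnCycle G master Q st s)
    (ha : Relation.ReflTransGen (E.Follows G master Q st) s a) : E.OnCycle G master Q st a := by
  induction ha with
  | refl => exact h
  | tail _ hb ih => exact ih.of_follows hb

theorem OnCycle.exists_pred {s : S} (h : E.OnCycle G master Q st s) :
    ∃ a, E.OnCycle G master Q st a ∧ E.Follows G master Q st a s := by
  obtain ⟨a, hsa, ha⟩ := Relation.TransGen.tail'_iff.1 h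
  exact ⟨a, Relation.TransGen.head' ha hsa, ha⟩

theorem ttcStep_matching_of_onCycle {s : S} {v : C × T} (h : E.OnCycle G master Q st s)
    (hv : E.StudentPointsTo G Q st s v) : (E.ttcStep G master Q st).matching s = v := by
  have hex : ∃ v, E.OnCycle G master Q st s ∧ E.StudentPointsTo G Q st s v := ⟨v, h, hv⟩
  simp only [ttcStep, dif_pos hex]
  exact hex.choose_spec.2.unique hv

theorem ttcStep_matching_of_not_onCycle {s : S} (h : ¬ E.OnCycle G master Q st s) :
    (E.ttcStep G master Q st).matching s = st.matching s := by
  simp only [ttcStep]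
  exact dif_neg fun ⟨_, hv⟩ => h hv.1

theorem mem_ttcStep_students {s : S} : s ∈ (E.ttcStep G master Q st).students ↔
    s ∈ st.students ∧ ¬ E.OnCycle G master Q st s := by
  simp [ttcStep]

/-- Up to a permutation of the students along the cycles, executing the cycles replaces the pair
of each student on a cycle by the pair that points to her on this cycle. -/
theorem exists_reassignment (E : Problem S D C T) (G : Set (Distribution C T))
    (master : StrictOrder S) (Q : S → StrictOrder (C × T)) (st : TTCState S C T) :
    ∃ Y : S → C × T, pairDist Y = pairDist (E.ttcStep G master Q st).matching ∧
      (∀ s, ¬ E.OnCycle G master Q st s → Y s = st.matching s) ∧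
      ∀ s, E.OnCycle G master Q st s → E.PairPointsTo G master st (Y s) s := by
  have hg : ∀ s, ∃ a, (E.OnCycle G master Q st s → E.Follows G master Q st s a) ∧
      (¬ E.OnCycle G master Q st s → a = s) := by
    intro s
    by_cases h : E.OnCycle G master Q st s
    · obtain ⟨a, ha⟩ := h.exists_follows
      exact ⟨a, fun _ => ha, fun h' => absurd h h'⟩
    · exact ⟨s, fun h' => absurd h' h, fun _ => rfl⟩
  choose g hg1 hg2 using hg
  have hsurj : Function.Surjective g := by
    intro s
    by_cases h : E.OnCycle G master Q st s
    · obtain ⟨a, ha, has⟩ := h.exists_pred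
      exact ⟨a, (hg1 a ha).unique has⟩
    · exact ⟨s, hg2 s h⟩
  let e : S ≃ S := Equiv.ofBijective g ⟨Finite.injective_iff_surjective.2 hsurj, hsurj⟩
  refine ⟨(E.ttcStep G master Q st).matching ∘ e.symm, pairDist_comp_equiv _ _,
    fun s hs => ?_, fun s hs => ?_⟩
  · have : e.symm s = s := e.symm_apply_eq.2 (hg2 s hs).symm
    rw [Function.comp_apply, this, ttcStep_matching_of_not_onCycle hs]
  · obtain ⟨a, ha, has⟩ := hs.exists_pred
    have : e.symm s = a := e.symm_apply_eq.2 (has.unique (hg1 a ha))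
    obtain ⟨v, hv, hvs⟩ := has
    rw [Function.comp_apply, this, ttcStep_matching_of_onCycle ha hv]
    exact hvs

end Problem

/-! ### The invariant of the algorithm and the persistence of pointing -/

namespace Problem

variable {S D C T : Type*} [Fintype S] [Fintype D] [Fintype C] [Fintype T]
variable {E : Problem S D C T} {floor ceil : C → T → ℕ} {master : StrictOrder S}
variable {Q : S → StrictOrder (C × T)} {st : TTCState S C T}

/-- The invariant of the algorithm: the current matching satisfies the policy within the capacities,
and every unassigned student holds her initial pair, which has not been removed. -/
structure Valid (E : Problem S D C T) (floor ceil : C → T → ℕ) (st : TTCState S C T) : Prop where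
  mem : pairDist st.matching ∈ E.feasiblePolicy floor ceil
  holds : ∀ s ∈ st.students, st.matching s = E.initialPair s
  owned : ∀ s ∈ st.students, E.initialPair s ∈ st.pairs

theorem Valid.permissible_iff (h : E.Valid floor ceil st) {v : C × T} {s : S}
    (hs : s ∈ st.students) :
    E.Permissible (E.combinedPolicy floor ceil) st.matching v s ↔ v = E.initialPair s ∨
      (pairDist st.matching v < ceil v.1 v.2 ∧
        floor (E.initialPair s).1 (E.initialPair s).2 < pairDist st.matching (E.initialPair s) ∧
        E.schoolDistrict v.1 = E.schoolDistrict (E.initialPair s).1 ∧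
        (v.1 = (E.initialPair s).1 ∨ (Finset.univ.filter fun s' =>
          (st.matching s').1 = v.1).card < E.capacity v.1)) :=
  Problem.permissible_iff h.mem (h.holds s hs)

theorem Valid.permissible_initialPair (h : E.Valid floor ceil st) {s : S} (hs : s ∈ st.students) :
    E.Permissible (E.combinedPolicy floor ceil) st.matching (E.initialPair s) s :=
  (h.permissible_iff hs).2 (Or.inl rfl)

theorem Valid.initialPair_mem_remainingPairs (h : E.Valid floor ceil st) {s : S}
    (hs : s ∈ st.students) :
    E.initialPair s ∈ E.remainingPairs (E.combinedPolicy floor ceil) st :=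
  Finset.mem_filter.2 ⟨h.owned s hs, s, hs, h.permissible_initialPair hs⟩

/-- Executing all cycles preserves the policy. Every pair loses at most one student, because all
other pairs agree on the student with this initial pair to whom they prefer to point; and a school
with free seats gains at most one student, because all pairs of such schools in a district that can
admit a student of another school point to the same student. -/
theorem Valid.pairDist_ttcStep_mem (h : E.Valid floor ceil st) :
    pairDist (E.ttcStep (E.combinedPolicy floor ceil) master Q st).matching ∈
      E.feasiblePolicy floor ceil := by
  obtain ⟨Y, hY, hoff, hon⟩ := exists_reassignment E (E.combinedPolicy floor ceil) master Q st
  have hinit : ∀ s, E.OnCycle (E.combinedPolicy floor ceil) master Q st s →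
      st.matching s = E.initialPair s := fun s hs => h.holds s hs.mem_students
  obtain ⟨hbd, hdist, hcap⟩ := mem_feasiblePolicy_pairDist_iff.1 h.mem
  rw [← hY, mem_feasiblePolicy_pairDist_iff]
  refine ⟨fun u => ⟨?_, ?_⟩, fun d => ?_, fun c => ?_⟩
  · by_cases hex : ∃ s, E.OnCycle (E.combinedPolicy floor ceil) master Q st s ∧
        E.initialPair s = u ∧ Y s ≠ u
    · obtain ⟨s, hs, rfl, hYs⟩ := hex
      have hperm := ((h.permissible_iff hs.mem_students).1 (hon s hs).2.2.1).resolve_left hYs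
      refine Nat.le_of_lt_succ (hperm.2.1.trans_le (pairDist_le_add_one s fun s' hne hs' => ?_))
      by_cases hs'c : E.OnCycle (E.combinedPolicy floor ceil) master Q st s'
      · by_contra hYs'
        have hin : E.initialPair s' = E.initialPair s := (hinit s' hs'c).symm.trans hs'
        refine hne ((hon s' hs'c).eq_of_permissible (hin ▸ hYs') (hon s hs) hYs ?_ ?_)
        · have := (hon s' hs'c).2.2.1
          unfold Permissible at this ⊢
          rwa [hin] at this
        · have := (hon s hs).2.2.1
          unfold Permissible at this ⊢
          rwa [hin]
      · exact (hoff s' hs'c).trans hs'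
    · push Not at hex
      refine (hbd u).1.trans (pairDist_le_of_imp fun s' hs' => ?_)
      by_cases hs'c : E.OnCycle (E.combinedPolicy floor ceil) master Q st s'
      · exact hex s' hs'c ((hinit s' hs'c).symm.trans hs')
      · exact (hoff s' hs'c).trans hs'
  · by_cases hex : ∃ s, E.OnCycle (E.combinedPolicy floor ceil) master Q st s ∧
        Y s = u ∧ E.initialPair s ≠ u
    · -- The pair `u` points to `s` only, so `s` is the only student who comes to `u`.
      obtain ⟨s, hs, rfl, hne⟩ := hex
      have hperm := ((h.permissible_iff hs.mem_students).1 (hon s hs).2.2.1).resolve_left hne.symm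
      refine (pairDist_le_add_one s fun s' hne' hs' => ?_).trans hperm.1
      by_cases hs'c : E.OnCycle (E.combinedPolicy floor ceil) master Q st s'
      · have := hon s' hs'c
        rw [hs'] at this
        exact absurd (this.unique (hon s hs)) hne'
      · exact (hoff s' hs'c).symm.trans hs'
    · push Not at hex
      refine le_trans (pairDist_le_of_imp fun s' hs' => ?_) (hbd u).2
      by_cases hs'c : E.OnCycle (E.combinedPolicy floor ceil) master Q st s'
      · exact (hinit s' hs'c).trans (hex s' hs'c hs')
      · exact (hoff s' hs'c).symm.trans hs'
  · rw [← hdist d]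
    refine congrArg Finset.card (Finset.filter_congr fun s _ => ?_)
    suffices hd : E.schoolDistrict (Y s).1 = E.schoolDistrict (st.matching s).1 by rw [hd]
    by_cases hs : E.OnCycle (E.combinedPolicy floor ceil) master Q st s
    · rw [hinit s hs]
      rcases (h.permissible_iff hs.mem_students).1 (hon s hs).2.2.1 with h1 | h1
      · rw [h1]
      · exact h1.2.2.1
    · rw [hoff s hs]
  · by_cases hex : ∃ s, E.OnCycle (E.combinedPolicy floor ceil) master Q st s ∧
        (Y s).1 = c ∧ (E.initialPair s).1 ≠ c
    · -- The school has a free seat, and `s` is the only student who comes from another school.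
      obtain ⟨s, hs, rfl, hne⟩ := hex
      have hYs : Y s ≠ E.initialPair s := fun heq => hne (heq ▸ rfl)
      obtain ⟨a1, a2, a3, a4⟩ :=
        ((h.permissible_iff hs.mem_students).1 (hon s hs).2.2.1).resolve_left hYs
      have hfree := a4.resolve_left hne.symm
      refine (card_filter_le_add_one s fun s' hne' hs' => ?_).trans hfree
      by_cases hs'c : E.OnCycle (E.combinedPolicy floor ceil) master Q st s'
      · by_contra hout
        rw [hinit s' hs'c] at hout
        have hYs' : Y s' ≠ E.initialPair s' := fun heq => hout (heq ▸ hs')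
        obtain ⟨b1, b2, b3, -⟩ :=
          ((h.permissible_iff hs'c.mem_students).1 (hon s' hs'c).2.2.1).resolve_left hYs'
        refine hne' ((hon s' hs'c).eq_of_permissible hYs' (hon s hs) hYs ?_ ?_)
        · refine (h.permissible_iff hs.mem_students).2 (Or.inr ⟨b1, a2, ?_, Or.inr ?_⟩)
          · rw [hs', a3]
          · rwa [hs']
        · refine (h.permissible_iff hs'c.mem_students).2 (Or.inr ⟨a1, b2, ?_, Or.inr hfree⟩)
          rw [← hs', b3]
      · rwa [← hoff s' hs'c]
    · push Not at hex
      refine le_trans (card_filter_le_of_imp fun s' hs' => ?_) (hcap c)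
      by_cases hs'c : E.OnCycle (E.combinedPolicy floor ceil) master Q st s'
      · rw [hinit s' hs'c]
        exact hex s' hs'c hs'
      · rwa [← hoff s' hs'c]

theorem Valid.ttcStep (h : E.Valid floor ceil st) :
    E.Valid floor ceil (E.ttcStep (E.combinedPolicy floor ceil) master Q st) where
  mem := h.pairDist_ttcStep_mem
  holds s hs := by
    obtain ⟨hs, hc⟩ := mem_ttcStep_students.1 hs
    rw [ttcStep_matching_of_not_onCycle hc, h.holds s hs]
  owned s hs := h.initialPair_mem_remainingPairs (mem_ttcStep_students.1 hs).1

/-- A pair goes on pointing to a student as long as she is not assigned: she remains permissible,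
and no student with a higher priority becomes permissible. -/
theorem Valid.pairPointsTo_ttcStep (h : E.Valid floor ceil st) {v : C × T} {s : S}
    (hvs : E.PairPointsTo (E.combinedPolicy floor ceil) master st v s)
    (hs : ¬ E.OnCycle (E.combinedPolicy floor ceil) master Q st s) :
    E.PairPointsTo (E.combinedPolicy floor ceil) master
      (E.ttcStep (E.combinedPolicy floor ceil) master Q st) v s := by
  obtain ⟨Y, hY, hoff, hon⟩ := exists_reassignment E (E.combinedPolicy floor ceil) master Q st
  have hinit : ∀ s, E.OnCycle (E.combinedPolicy floor ceil) master Q st s →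
      st.matching s = E.initialPair s := fun s hs => h.holds s hs.mem_students
  have hYmem : pairDist Y ∈ E.feasiblePolicy floor ceil := hY ▸ h.pairDist_ttcStep_mem
  have hs' : s ∈ (E.ttcStep (E.combinedPolicy floor ceil) master Q st).students :=
    mem_ttcStep_students.2 ⟨hvs.2.1, hs⟩
  have hiff : ∀ {w : C × T} {a : S},
      a ∈ (E.ttcStep (E.combinedPolicy floor ceil) master Q st).students →
      (E.Permissible (E.combinedPolicy floor ceil)
        (E.ttcStep (E.combinedPolicy floor ceil) master Q st).matching w a ↔
        w = E.initialPair a ∨ (pairDist Y w < ceil w.1 w.2 ∧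
          floor (E.initialPair a).1 (E.initialPair a).2 < pairDist Y (E.initialPair a) ∧
          E.schoolDistrict w.1 = E.schoolDistrict (E.initialPair a).1 ∧
          (w.1 = (E.initialPair a).1 ∨
            (Finset.univ.filter fun b => (Y b).1 = w.1).card < E.capacity w.1))) := by
    intro w a ha
    obtain ⟨ha, hac⟩ := mem_ttcStep_students.1 ha
    rw [← Problem.permissible_iff hYmem ((hoff a hac).trans (h.holds a ha))]
    unfold Permissible
    rw [hY]
  have hne_of : ∀ {a}, E.OnCycle (E.combinedPolicy floor ceil) master Q st a → a ≠ s := by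
    rintro a ha rfl
    exact hs ha
  have hperm := (h.permissible_iff hvs.2.1).1 hvs.2.2.1
  have hperm' : E.Permissible (E.combinedPolicy floor ceil)
      (E.ttcStep (E.combinedPolicy floor ceil) master Q st).matching v s := by
    rw [hiff hs']
    refine or_iff_not_imp_left.2 fun hv => ?_
    obtain ⟨a1, a2, a3, a4⟩ := hperm.resolve_left hv
    refine ⟨(pairDist_le_of_imp fun b hb => ?_).trans_lt a1,
      a2.trans_le (pairDist_le_of_imp fun b hb => ?_), a3, ?_⟩
    · by_cases hbc : E.OnCycle (E.combinedPolicy floor ceil) master Q st b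
      · have := hon b hbc
        rw [hb] at this
        exact absurd (this.unique hvs) (hne_of hbc)
      · exact (hoff b hbc).symm.trans hb
    · by_cases hbc : E.OnCycle (E.combinedPolicy floor ceil) master Q st b
      · by_contra hYb
        have hin : E.initialPair b = E.initialPair s := (hinit b hbc).symm.trans hb
        refine hne_of hbc ((hon b hbc).eq_of_permissible (hin ▸ hYb) hvs hv ?_ ?_)
        · have := (hon b hbc).2.2.1
          unfold Permissible at this ⊢
          rwa [hin] at this
        · have := hvs.2.2.1
          unfold Permissible at this ⊢
          rwa [hin]
      · exact (hoff b hbc).trans hb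
    · refine a4.imp_right fun hfree => (card_filter_le_of_imp fun b hb => ?_).trans_lt hfree
      by_cases hbc : E.OnCycle (E.combinedPolicy floor ceil) master Q st b
      · by_contra hout
        rw [hinit b hbc] at hout
        have hYb : Y b ≠ E.initialPair b := fun heq => hout (heq ▸ hb)
        obtain ⟨b1, b2, b3, -⟩ :=
          ((h.permissible_iff hbc.mem_students).1 (hon b hbc).2.2.1).resolve_left hYb
        refine hne_of hbc ((hon b hbc).eq_of_permissible hYb hvs hv ?_ ?_)
        · refine (h.permissible_iff hvs.2.1).2 (Or.inr ⟨b1, a2, ?_, Or.inr ?_⟩)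
          · rw [hb, a3]
          · rwa [hb]
        · refine (h.permissible_iff hbc.mem_students).2 (Or.inr ⟨a1, b2, ?_, Or.inr hfree⟩)
          rw [← hb, b3]
      · rwa [← hoff b hbc]
  refine ⟨Finset.mem_filter.2 ⟨hvs.1, s, hs', hperm'⟩, hs', hperm', fun a ha hpa hne => ?_⟩
  have haU := (mem_ttcStep_students.1 ha).1
  by_cases hpa' : E.Permissible (E.combinedPolicy floor ceil) st.matching v a
  · exact hvs.2.2.2 a haU hpa' hne
  rw [h.permissible_iff haU, not_or] at hpa'
  obtain ⟨hva, hpa'⟩ := hpa'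
  by_cases hv : v = E.initialPair s
  · exact Or.inl ⟨hv.symm, Ne.symm hva⟩
  -- The student `a` has become permissible although she has not been before: this requires a loss
  -- of a student at the school of `v`, which has been full, but such a loss involves `s`.
  exfalso
  obtain ⟨-, c2, c3, c4⟩ := ((hiff ha).1 hpa).resolve_left hva
  obtain ⟨a1, a2, a3, a4⟩ := hperm.resolve_left hv
  have hfloor : pairDist Y (E.initialPair a) ≤ pairDist st.matching (E.initialPair a) := by
    refine pairDist_le_of_imp fun b hb => ?_
    by_cases hbc : E.OnCycle (E.combinedPolicy floor ceil) master Q st b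
    · by_contra hout
      rw [hinit b hbc] at hout
      have hab : a ≠ b := by
        rintro rfl
        exact hout rfl
      refine ((hon b hbc).master_rel (hb.trans_ne (Ne.symm hout)) haU ?_ hab).2 hb
      rw [hb]
      exact h.permissible_initialPair haU
    · exact (hoff b hbc).symm.trans hb
  have hnot : ¬ (v.1 = (E.initialPair a).1 ∨ (Finset.univ.filter fun s' =>
      (st.matching s').1 = v.1).card < E.capacity v.1) :=
    fun h4 => hpa' ⟨a1, c2.trans_le hfloor, c3, h4⟩
  rw [not_or] at hnot
  have hfree := c4.resolve_left hnot.1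
  have hschool := a4.resolve_right hnot.2
  refine hnot.2 (lt_of_le_of_lt (card_filter_le_of_imp fun b hb => ?_) hfree)
  by_cases hbc : E.OnCycle (E.combinedPolicy floor ceil) master Q st b
  · by_contra hout
    rw [hinit b hbc] at hb
    have hYb : Y b ≠ E.initialPair b := fun heq => hout (heq ▸ hb)
    obtain ⟨b1, b2, b3, b4⟩ :=
      ((h.permissible_iff hbc.mem_students).1 (hon b hbc).2.2.1).resolve_left hYb
    rw [hb] at b3 b4
    refine hne_of hbc ((hon b hbc).eq_of_permissible hYb hvs hv ?_ ?_)
    · refine (h.permissible_iff hvs.2.1).2 (Or.inr ⟨b1, a2, ?_, Or.inr (b4.resolve_left hout)⟩)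
      rw [b3, a3]
    · refine (h.permissible_iff hbc.mem_students).2 (Or.inr ⟨a1, b2, ?_, Or.inl hb.symm⟩)
      rw [hb]
  · rwa [hoff b hbc]

end Problem

/-! ### Termination and the outcome of the algorithm -/

namespace Problem

variable {S D C T : Type*} [Fintype S] [Fintype D] [Fintype C] [Fintype T]
variable {E : Problem S D C T} {floor ceil : C → T → ℕ} {master : StrictOrder S}
variable {Q Q' : S → StrictOrder (C × T)} {st : TTCState S C T}

/-- As long as a student is unassigned there is a cycle, since all unassigned students and all
remaining pairs point. -/
theorem Valid.exists_onCycle (h : E.Valid floor ceil st) (hne : st.students.Nonempty) :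
    ∃ s ∈ st.students, E.OnCycle (E.combinedPolicy floor ceil) master Q st s := by
  by_contra! hcon
  have hirr : ∀ s, ¬ Relation.TransGen
      (E.Follows (E.combinedPolicy floor ceil) master Q st) s s := fun s hs =>
    hcon s (OnCycle.mem_students hs) hs
  let r : S → S → Prop := fun a b =>
    Relation.TransGen (E.Follows (E.combinedPolicy floor ceil) master Q st) b a
  have : IsTrans S r := ⟨fun _ _ _ h1 h2 => h2.trans h1⟩
  have : Std.Irrefl r := ⟨hirr⟩
  obtain ⟨s, hs, hmin⟩ :=
    (Finite.wellFounded_of_trans_of_irrefl r).has_min {s | s ∈ st.students} hne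
  obtain ⟨v, hv⟩ := exists_studentPointsTo (Q := Q) hs ⟨_, h.initialPair_mem_remainingPairs hs⟩
  obtain ⟨a, ha⟩ := exists_pairPointsTo (master := master) hv.2.1
  exact hmin a ha.2.1 (Relation.TransGen.single ⟨v, hv, ha⟩)

theorem valid_ttcState (h0 : pairDist E.initialPair ∈ E.feasiblePolicy floor ceil) (n : ℕ) :
    E.Valid floor ceil (E.ttcState (E.combinedPolicy floor ceil) master Q n) := by
  induction n with
  | zero => exact ⟨h0, fun _ _ => rfl, fun _ _ => Finset.mem_univ _⟩
  | succ n ih => exact ih.ttcStep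

variable {G : Set (Distribution C T)}

theorem ttcState_students_antitone : Antitone fun n => (E.ttcState G master Q n).students :=
  antitone_nat_of_succ_le fun _ => Finset.filter_subset _ _

theorem ttcState_pairs_antitone : Antitone fun n => (E.ttcState G master Q n).pairs :=
  antitone_nat_of_succ_le fun _ => Finset.filter_subset _ _

theorem remainingPairs_antitone :
    Antitone fun n => E.remainingPairs G (E.ttcState G master Q n) :=
  fun _ _ hmn => ttcState_pairs_antitone (Nat.succ_le_succ hmn)

theorem exists_students_eq_empty (h0 : pairDist E.initialPair ∈ E.feasiblePolicy floor ceil) :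
    ∃ n, (E.ttcState (E.combinedPolicy floor ceil) master Q n).students = ∅ := by
  have hcard : ∀ n, (E.ttcState (E.combinedPolicy floor ceil) master Q n).students = ∅ ∨
      (E.ttcState (E.combinedPolicy floor ceil) master Q n).students.card + n ≤
        Fintype.card S := by
    intro n
    induction n with
    | zero => exact Or.inr (Finset.card_le_univ _)
    | succ n ih =>
      rcases Finset.eq_empty_or_nonempty
        (E.ttcState (E.combinedPolicy floor ceil) master Q n).students with he | hne
      · left
        exact Finset.subset_empty.1 (he ▸ ttcState_students_antitone n.le_succ)
      · right
        obtain ⟨s, hs, hc⟩ := (valid_ttcState h0 n).exists_onCycle (master := master) (Q := Q) hne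
        have hlt : (E.ttcState (E.combinedPolicy floor ceil) master Q (n + 1)).students.card <
            (E.ttcState (E.combinedPolicy floor ceil) master Q n).students.card :=
          Finset.card_lt_card ((Finset.ssubset_iff_of_subset
            (ttcState_students_antitone n.le_succ)).2
              ⟨s, hs, fun hs' => (mem_ttcStep_students.1 hs').2 hc⟩)
        have := ih.resolve_left hne.ne_empty
        omega
  rcases hcard (Fintype.card S + 1) with h | h
  · exact ⟨_, h⟩
  · omega

/-- The number of steps the algorithm takes. -/
noncomputable def ttcLength (E : Problem S D C T) (G : Set (Distribution C T))
    (master : StrictOrder S) (Q : S → StrictOrder (C × T)) : ℕ :=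
  sInf {n | (E.ttcState G master Q n).students = ∅}

/-- The pairs that the students hold at the end of the algorithm. -/
noncomputable def ttcAssignment (E : Problem S D C T) (G : Set (Distribution C T))
    (master : StrictOrder S) (Q : S → StrictOrder (C × T)) : S → C × T :=
  (E.ttcState G master Q (E.ttcLength G master Q)).matching

theorem students_ttcLength (h0 : pairDist E.initialPair ∈ E.feasiblePolicy floor ceil) :
    (E.ttcState (E.combinedPolicy floor ceil) master Q
      (E.ttcLength (E.combinedPolicy floor ceil) master Q)).students = ∅ :=
  Nat.sInf_mem (exists_students_eq_empty h0)

theorem ttcState_matching_eq_of_notMem {n m : ℕ} (hnm : n ≤ m) {s : S}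
    (hs : s ∉ (E.ttcState G master Q n).students) :
    (E.ttcState G master Q m).matching s = (E.ttcState G master Q n).matching s := by
  induction m, hnm using Nat.le_induction with
  | base => rfl
  | succ m hnm ih =>
    rw [← ih]
    exact ttcStep_matching_of_not_onCycle fun hc =>
      hs (ttcState_students_antitone hnm hc.mem_students)

/-- Every student leaves at some step, at which she is on a cycle and points to the pair that she
finally holds. -/
theorem exists_assignment_step (h0 : pairDist E.initialPair ∈ E.feasiblePolicy floor ceil)
    (s : S) :
    ∃ n, (∀ m ≤ n, s ∈ (E.ttcState (E.combinedPolicy floor ceil) master Q m).students) ∧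
      E.OnCycle (E.combinedPolicy floor ceil) master Q
        (E.ttcState (E.combinedPolicy floor ceil) master Q n) s ∧
      E.StudentPointsTo (E.combinedPolicy floor ceil) Q
        (E.ttcState (E.combinedPolicy floor ceil) master Q n) s
        (E.ttcAssignment (E.combinedPolicy floor ceil) master Q s) ∧
      n < E.ttcLength (E.combinedPolicy floor ceil) master Q := by
  have hex : ∃ n, s ∉ (E.ttcState (E.combinedPolicy floor ceil) master Q n).students :=
    ⟨_, by rw [students_ttcLength h0]; simp⟩
  obtain ⟨n, hn⟩ : ∃ n, Nat.find hex = n + 1 := by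
    refine Nat.exists_eq_succ_of_ne_zero fun hzero => ?_
    have := Nat.find_spec hex
    rw [hzero] at this
    exact this (Finset.mem_univ s)
  have hmem : ∀ m ≤ n, s ∈ (E.ttcState (E.combinedPolicy floor ceil) master Q m).students :=
    fun m hm => not_not.1 (Nat.find_min hex (by omega))
  have hnot : s ∉ (E.ttcState (E.combinedPolicy floor ceil) master Q (n + 1)).students :=
    hn ▸ Nat.find_spec hex
  have hc : E.OnCycle (E.combinedPolicy floor ceil) master Q
      (E.ttcState (E.combinedPolicy floor ceil) master Q n) s :=
    not_not.1 fun hc => hnot (mem_ttcStep_students.2 ⟨hmem n le_rfl, hc⟩)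
  obtain ⟨a, v, hv, -⟩ := hc.exists_follows
  have hlen : n + 1 ≤ E.ttcLength (E.combinedPolicy floor ceil) master Q :=
    hn ▸ Nat.find_min' hex (by rw [students_ttcLength h0]; simp)
  have heq : E.ttcAssignment (E.combinedPolicy floor ceil) master Q s = v :=
    (ttcState_matching_eq_of_notMem hlen hnot).trans (ttcStep_matching_of_onCycle hc hv)
  exact ⟨n, hmem, hc, heq ▸ hv, hlen⟩

theorem pairDist_ttcAssignment_mem
    (h0 : pairDist E.initialPair ∈ E.feasiblePolicy floor ceil) :
    pairDist (E.ttcAssignment (E.combinedPolicy floor ceil) master Q) ∈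
      E.feasiblePolicy floor ceil :=
  (valid_ttcState h0 _).mem

/-- No student ends up with a pair that she ranks below her initial pair. -/
theorem ttcAssignment_eq_or_rel (h0 : pairDist E.initialPair ∈ E.feasiblePolicy floor ceil)
    (s : S) :
    E.ttcAssignment (E.combinedPolicy floor ceil) master Q s = E.initialPair s ∨
      (Q s).rel (E.ttcAssignment (E.combinedPolicy floor ceil) master Q s) (E.initialPair s) := by
  obtain ⟨n, hmem, -, hv, -⟩ := exists_assignment_step (master := master) (Q := Q) h0 s
  refine or_iff_not_imp_left.2 fun hne => hv.2.2 _ ?_ (Ne.symm hne)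
  exact (valid_ttcState h0 n).initialPair_mem_remainingPairs (hmem n le_rfl)

/-! ### Efficiency -/

/-- A pair that has been removed cannot be given to an unassigned student: otherwise M-convexity,
applied to the current and the new distribution, would make some unassigned student permissible to
this pair. -/
theorem ne_of_not_permissible (h : E.Valid floor ceil st) {Y : S → C × T}
    (hY : pairDist Y ∈ E.feasiblePolicy floor ceil)
    (hagree : ∀ s, s ∉ st.students → Y s = st.matching s) {v : C × T}
    (hv : ∀ s ∈ st.students, ¬ E.Permissible (E.combinedPolicy floor ceil) st.matching v s)
    {s : S} (hs : s ∈ st.students) : Y s ≠ v := by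
  intro hYs
  by_cases hlt : pairDist st.matching v < pairDist Y v
  · obtain ⟨w, hw, -, hmem⟩ := mConvex_feasiblePolicy _ hY _ h.mem v hlt
    obtain ⟨a, ha, haw⟩ : ∃ a ∈ st.students, st.matching a = w := by
      by_contra! hcon
      refine absurd hw (not_lt.2 (pairDist_le_of_imp fun a ha => ?_))
      rw [hagree a fun haU => hcon a haU ha, ha]
    refine hv a ha ?_
    unfold Permissible
    rwa [← h.holds a ha, haw]
  · -- `v` is not gained, so some unassigned student owns it, and she is permissible to it.
    obtain ⟨a, ha, hav⟩ : ∃ a ∈ st.students, st.matching a = v := by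
      by_contra! hcon
      have hsub : ∀ a, st.matching a = v → Y a = v := fun a ha => by
        rw [hagree a fun haU => hcon a haU ha, ha]
      refine hlt (Finset.card_lt_card ((Finset.ssubset_iff_of_subset
        (Finset.monotone_filter_right _ fun a _ => hsub a)).2 ⟨s, by simpa using hYs, ?_⟩))
      simpa using hcon s hs
    refine hv a ha ?_
    rw [← hav, h.holds a ha]
    exact h.permissible_initialPair ha

/-- A pair that is not remaining has been removed at some step because no unassigned student was
permissible to it. -/
theorem exists_not_permissible_of_notMem {n : ℕ} {v : C × T}
    (hv : v ∉ E.remainingPairs G (E.ttcState G master Q n)) :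
    ∃ m ≤ n, ∀ s ∈ (E.ttcState G master Q m).students,
      ¬ E.Permissible G (E.ttcState G master Q m).matching v s := by
  induction n with
  | zero =>
    refine ⟨0, le_rfl, fun s hs hp => hv (Finset.mem_filter.2 ⟨Finset.mem_univ v, s, hs, hp⟩)⟩
  | succ n ih =>
    by_cases hn : v ∈ E.remainingPairs G (E.ttcState G master Q n)
    · exact ⟨n + 1, le_rfl, fun s hs hp => hv (Finset.mem_filter.2 ⟨hn, s, hs, hp⟩)⟩
    · obtain ⟨m, hm, h⟩ := ih hn
      exact ⟨m, hm.trans n.le_succ, h⟩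

/-- An assignment that satisfies the policy and that all students weakly prefer to the outcome of
the algorithm is this outcome: by induction on the step at which a student leaves, all pairs that
she prefers to her own are out of reach. -/
theorem eq_ttcAssignment_of_weak (h0 : pairDist E.initialPair ∈ E.feasiblePolicy floor ceil)
    {Y : S → C × T} (hY : pairDist Y ∈ E.feasiblePolicy floor ceil)
    (hweak : ∀ s, Y s = E.ttcAssignment (E.combinedPolicy floor ceil) master Q s ∨
      (Q s).rel (Y s) (E.ttcAssignment (E.combinedPolicy floor ceil) master Q s)) :
    Y = E.ttcAssignment (E.combinedPolicy floor ceil) master Q := by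
  have key : ∀ n s, s ∉ (E.ttcState (E.combinedPolicy floor ceil) master Q n).students →
      Y s = E.ttcAssignment (E.combinedPolicy floor ceil) master Q s := by
    intro n
    induction n with
    | zero => exact fun s hs => absurd (Finset.mem_univ s) hs
    | succ n ih =>
      intro s hs
      by_cases hsn : s ∈ (E.ttcState (E.combinedPolicy floor ceil) master Q n).students
      swap
      · exact ih s hsn
      obtain ⟨k, hmem, hc, hv, hlen⟩ := exists_assignment_step (master := master) (Q := Q) h0 s
      have hkn : k = n := by
        refine le_antisymm (not_lt.1 fun hlt => hs (hmem _ hlt)) (not_lt.1 fun hlt => ?_)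
        exact (mem_ttcStep_students.1 (ttcState_students_antitone (Nat.succ_le_of_lt hlt) hsn)).2 hc
      subst hkn
      refine (hweak s).resolve_right fun hrel => ?_
      have hnot : Y s ∉ E.remainingPairs (E.combinedPolicy floor ceil)
          (E.ttcState (E.combinedPolicy floor ceil) master Q k) := by
        intro hin
        have hne : Y s ≠ E.ttcAssignment (E.combinedPolicy floor ceil) master Q s := fun heq =>
          (Q s).irrefl _ (heq ▸ hrel)
        exact (Q s).asymm hrel (hv.2.2 _ hin hne)
      obtain ⟨m, hm, hperm⟩ := exists_not_permissible_of_notMem hnot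
      refine ne_of_not_permissible (valid_ttcState h0 m) hY (fun a ha => ?_) hperm (hmem m hm) rfl
      rw [ih a fun h => ha (ttcState_students_antitone hm h)]
      exact ttcState_matching_eq_of_notMem (hm.trans hlen.le) ha
  funext s
  exact key _ s (by rw [students_ttcLength h0]; simp)

/-! ### Manipulations by a single student -/

theorem StudentPointsTo.congr {s : S} (h : Q s = Q' s) {v : C × T}
    (hv : E.StudentPointsTo G Q st s v) : E.StudentPointsTo G Q' st s v := by
  unfold StudentPointsTo at hv ⊢
  rwa [← h]

theorem Follows.congr {s a : S} (h : Q s = Q' s) (ha : E.Follows G master Q st s a) :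
    E.Follows G master Q' st s a := by
  obtain ⟨v, hv, hva⟩ := ha
  exact ⟨v, hv.congr h, hva⟩

/-- A cycle that avoids `s` does not depend on the preferences of `s`. -/
theorem OnCycle.congr {s a : S} (hQ : ∀ b, b ≠ s → Q b = Q' b)
    (hs : ¬ E.OnCycle G master Q st s) (ha : E.OnCycle G master Q st a) :
    E.OnCycle G master Q' st a := by
  have hne : ∀ {b}, Relation.ReflTransGen (E.Follows G master Q st) a b → b ≠ s := by
    rintro b hb rfl
    exact hs (ha.of_reflTransGen hb)
  have key : ∀ b, Relation.TransGen (E.Follows G master Q st) a b →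
      Relation.TransGen (E.Follows G master Q' st) a b := by
    intro b hb
    induction hb with
    | single h => exact .single (h.congr (hQ a (hne .refl)))
    | tail hab h ih => exact ih.tail (h.congr (hQ _ (hne hab.to_reflTransGen)))
  exact key a ha

/-- If a student is on a cycle for neither of her reports, then the step does not depend on her
report. -/
theorem ttcStep_congr {s : S} (hQ : ∀ b, b ≠ s → Q b = Q' b)
    (hs : ¬ E.OnCycle G master Q st s) (hs' : ¬ E.OnCycle G master Q' st s) :
    E.ttcStep G master Q st = E.ttcStep G master Q' st := by
  have hiff : ∀ a, E.OnCycle G master Q st a ↔ E.OnCycle G master Q' st a := fun a =>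
    ⟨fun h => h.congr hQ hs, fun h => h.congr (fun b hb => (hQ b hb).symm) hs'⟩
  have hmatch : (E.ttcStep G master Q st).matching = (E.ttcStep G master Q' st).matching := by
    funext a
    by_cases ha : E.OnCycle G master Q st a
    · obtain ⟨b, v, hv, -⟩ := ha.exists_follows
      have hne : a ≠ s := by
        rintro rfl
        exact hs ha
      rw [ttcStep_matching_of_onCycle ha hv,
        ttcStep_matching_of_onCycle ((hiff a).1 ha) (hv.congr (hQ a hne))]
    · rw [ttcStep_matching_of_not_onCycle ha,
        ttcStep_matching_of_not_onCycle fun h => ha ((hiff a).2 h)]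
  have hstud : (E.ttcStep G master Q st).students = (E.ttcStep G master Q' st).students := by
    ext a
    rw [mem_ttcStep_students, mem_ttcStep_students, hiff]
  exact TTCState.mk.injEq .. |>.mpr ⟨hstud, rfl, hmatch⟩

theorem ttcState_congr {s : S} (hQ : ∀ b, b ≠ s → Q b = Q' b) {n : ℕ}
    (hs : s ∈ (E.ttcState G master Q n).students) (hs' : s ∈ (E.ttcState G master Q' n).students) :
    E.ttcState G master Q n = E.ttcState G master Q' n := by
  induction n with
  | zero => rfl
  | succ n ih =>
    obtain ⟨hs, hc⟩ := mem_ttcStep_students.1 hs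
    obtain ⟨hs', hc'⟩ := mem_ttcStep_students.1 hs'
    have hst := ih hs hs'
    rw [ttcState, ttcState, ← hst]
    exact ttcStep_congr hQ hc (hst ▸ hc')

/-- A path to `s` can be cut at its first arrival at `s`, so its existence does not depend on the
preferences of `s`. -/
theorem reflTransGen_follows_congr {s a : S} (hQ : ∀ b, b ≠ s → Q b = Q' b)
    (h : Relation.ReflTransGen (E.Follows G master Q st) a s) :
    Relation.ReflTransGen (E.Follows G master Q' st) a s := by
  induction h using Relation.ReflTransGen.head_induction_on with
  | refl => exact .refl
  | head hab _ ih =>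
    rename_i b _ _
    by_cases hb : b = s
    · rw [hb]
    · exact .head (hab.congr (hQ b hb)) ih

/-- A path in the pointing graph to a student persists as long as she is not assigned. -/
theorem Valid.reflTransGen_follows_ttcStep (h : E.Valid floor ceil st) {s a : S}
    (hs : ¬ E.OnCycle (E.combinedPolicy floor ceil) master Q st s)
    (ha : Relation.ReflTransGen (E.Follows (E.combinedPolicy floor ceil) master Q st) a s) :
    Relation.ReflTransGen (E.Follows (E.combinedPolicy floor ceil) master Q
      (E.ttcStep (E.combinedPolicy floor ceil) master Q st)) a s := by
  induction ha using Relation.ReflTransGen.head_induction_on with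
  | refl => exact .refl
  | head hab hbs ih =>
    obtain ⟨v, hv, hvb⟩ := hab
    have hb := fun hb => hs (OnCycle.of_reflTransGen hb hbs)
    have ha := fun ha => hb (OnCycle.of_follows ha ⟨v, hv, hvb⟩)
    have hvb' := h.pairPointsTo_ttcStep hvb hb
    refine .head ⟨v, ⟨mem_ttcStep_students.2 ⟨hv.1, ha⟩, hvb'.1, fun v' hv' => ?_⟩, hvb'⟩ ih
    exact hv.2.2 v' (Finset.mem_filter.1 hv').1

/-- If some path from the pair `v` leads to the student `s`, then `v` remains as long as `s` is
unassigned. -/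
theorem mem_remainingPairs_of_path (h0 : pairDist E.initialPair ∈ E.feasiblePolicy floor ceil)
    {n m : ℕ} (hnm : n ≤ m) {s a : S} {v : C × T}
    (hs : ∀ k < m, ¬ E.OnCycle (E.combinedPolicy floor ceil) master Q
      (E.ttcState (E.combinedPolicy floor ceil) master Q k) s)
    (hv : E.PairPointsTo (E.combinedPolicy floor ceil) master
      (E.ttcState (E.combinedPolicy floor ceil) master Q n) v a)
    (ha : Relation.ReflTransGen (E.Follows (E.combinedPolicy floor ceil) master Q
      (E.ttcState (E.combinedPolicy floor ceil) master Q n)) a s) :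
    v ∈ E.remainingPairs (E.combinedPolicy floor ceil)
      (E.ttcState (E.combinedPolicy floor ceil) master Q m) := by
  suffices h : E.PairPointsTo (E.combinedPolicy floor ceil) master
      (E.ttcState (E.combinedPolicy floor ceil) master Q m) v a ∧
      Relation.ReflTransGen (E.Follows (E.combinedPolicy floor ceil) master Q
        (E.ttcState (E.combinedPolicy floor ceil) master Q m)) a s from h.1.1
  induction m, hnm using Nat.le_induction with
  | base => exact ⟨hv, ha⟩
  | succ m _ ih =>
    obtain ⟨hva, has⟩ := ih fun k hk => hs k (hk.trans m.lt_succ_self)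
    have hsm := hs m m.lt_succ_self
    exact ⟨(valid_ttcState h0 m).pairPointsTo_ttcStep hva fun h => hsm (h.of_reflTransGen has),
      (valid_ttcState h0 m).reflTransGen_follows_ttcStep hsm has⟩

/-- A student never prefers the pair that she obtains by another report. If the other report makes
her leave later, then she gets the best pair available to her; if it makes her leave earlier, then
the pair that she would get stays available until she leaves. -/
theorem not_rel_ttcAssignment (h0 : pairDist E.initialPair ∈ E.feasiblePolicy floor ceil) {s : S}
    (hQ : ∀ b, b ≠ s → Q b = Q' b) :
    ¬ (Q s).rel (E.ttcAssignment (E.combinedPolicy floor ceil) master Q' s)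
      (E.ttcAssignment (E.combinedPolicy floor ceil) master Q s) := by
  intro hrel
  obtain ⟨m, hmem, hc, hv, -⟩ := exists_assignment_step (master := master) (Q := Q) h0 s
  obtain ⟨m', hmem', hc', hv', -⟩ := exists_assignment_step (master := master) (Q := Q') h0 s
  suffices hin : E.ttcAssignment (E.combinedPolicy floor ceil) master Q' s ∈
      E.remainingPairs (E.combinedPolicy floor ceil)
        (E.ttcState (E.combinedPolicy floor ceil) master Q m) by
    refine (Q s).asymm hrel (hv.2.2 _ hin fun heq => ?_)
    exact (Q s).irrefl _ (heq ▸ hrel)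
  rcases le_total m m' with hle | hle
  · rw [ttcState_congr hQ (hmem m le_rfl) (hmem' m hle)]
    exact remainingPairs_antitone hle hv'.2.1
  · have hst := ttcState_congr hQ (hmem m' hle) (hmem' m' le_rfl)
    obtain ⟨a, ⟨v, hva, hv'a⟩, has⟩ := Relation.TransGen.head'_iff.1 hc'
    obtain rfl := hva.unique hv'
    rw [← hst] at hv'a has
    refine mem_remainingPairs_of_path h0 hle (fun k hk hck => ?_) hv'a
      (reflTransGen_follows_congr (fun b hb => (hQ b hb).symm) has)
    exact (mem_ttcStep_students.1 (hmem (k + 1) hk)).2 hck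

end Problem

/-! ### Matchings of students with schools -/

section Graph

variable {S C : Type*}

theorem mem_of_outcome_eq_some {X : Matching S C} {s : S} {c : C} (h : outcome X s = some c) :
    (s, c) ∈ X := by
  by_cases hex : ∃ c, (s, c) ∈ X
  · rw [outcome, dif_pos hex] at h
    exact Option.some.inj h ▸ hex.choose_spec
  · rw [outcome, dif_neg hex] at h
    cases h

variable [Fintype S] [Fintype C]

/-- The matching in which every student `s` is matched with the school `f s`. -/
noncomputable def graphMatching (f : S → C) : Matching S C :=
  Finset.univ.filter fun x => f x.1 = x.2

theorem mem_graphMatching {f : S → C} {x : S × C} : x ∈ graphMatching f ↔ f x.1 = x.2 := by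
  simp [graphMatching]

theorem outcome_graphMatching (f : S → C) (s : S) : outcome (graphMatching f) s = some (f s) := by
  have h : ∃ c, (s, c) ∈ graphMatching f := ⟨f s, mem_graphMatching.2 rfl⟩
  rw [outcome, dif_pos h, mem_graphMatching.1 h.choose_spec]

theorem card_filter_graphMatching (f : S → C) (p : S × C → Prop)
    [DecidablePred p] :
    ((graphMatching f).filter p).card = (Finset.univ.filter fun s => p (s, f s)).card := by
  symm
  refine Finset.card_bij (fun s _ => (s, f s)) (fun s hs => ?_)
    (fun _ _ _ _ h => congrArg Prod.fst h) fun x hx => ?_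
  · simpa [mem_graphMatching] using hs
  · obtain ⟨hx, hp⟩ := Finset.mem_filter.1 hx
    have heq : (x.1, f x.1) = x := Prod.ext rfl (mem_graphMatching.1 hx)
    exact ⟨x.1, by simpa [heq] using hp, heq⟩

theorem feasible_graphMatching_iff {q : C → ℕ} {f : S → C} :
    Feasible q (graphMatching f) ↔ ∀ c, (Finset.univ.filter fun s => f s = c).card ≤ q c := by
  simp only [Feasible, card_filter_graphMatching, and_iff_right_iff_imp]
  intro _ s c c' h h'
  exact (mem_graphMatching.1 h).symm.trans (mem_graphMatching.1 h')

theorem eq_graphMatching {X : Matching S C} (hX : FeasibleForStudents X) {f : S → C}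
    (hf : ∀ s, (s, f s) ∈ X) : X = graphMatching f := by
  ext ⟨s, c⟩
  rw [mem_graphMatching]
  exact ⟨fun h => hX s _ _ (hf s) h, fun h : f s = c => h ▸ hf s⟩

end Graph

namespace Problem

variable {S D C T : Type*} [Fintype S] [Fintype C]

theorem initial_eq_graphMatching (E : Problem S D C T) :
    E.initial = graphMatching E.initialSchool :=
  eq_graphMatching E.initial_feasible.1 fun s => (E.initial_unique s).choose_spec.1

theorem dist_graphMatching (E : Problem S D C T) (f : S → C) :
    E.dist (graphMatching f) = pairDist fun s => (f s, E.type s) := by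
  funext v
  unfold dist pairDist
  rw [card_filter_graphMatching]
  exact congrArg Finset.card (Finset.filter_congr fun s _ =>
    (Prod.ext_iff (x := (f s, E.type s)) (y := v)).symm)

variable [Fintype D] [Fintype T]
variable {E : Problem S D C T} {floor ceil : C → T → ℕ}

theorem feasible_and_satisfies_iff {f : S → C} :
    Feasible E.capacity (graphMatching f) ∧
        E.Satisfies (E.combinedPolicy floor ceil) (graphMatching f) ↔
      (pairDist fun s => (f s, E.type s)) ∈ E.feasiblePolicy floor ceil := by
  rw [Satisfies, dist_graphMatching, feasible_graphMatching_iff]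
  constructor
  · rintro ⟨h1, h2⟩
    refine mem_feasiblePolicy_iff.2 ⟨fun u => h2.1 u.1 u.2,
      fun d => (sum_district_eq E _ d).symm.trans (h2.2 d), fun c => ?_⟩
    rw [sum_pairDist]
    exact h1 c
  · intro h
    exact ⟨(mem_feasiblePolicy_pairDist_iff.1 h).2.2, h.1⟩

variable {master : StrictOrder S} {H : E.HypotheticalPreferences} {G : Set (Distribution C T)}

theorem ttc_eq_graphMatching (P : S → StudentPref C) :
    E.ttc G master H P =
      graphMatching fun s => (E.ttcAssignment G master (fun s => H.pref s (P s)) s).1 :=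
  rfl

theorem ttcAssignment_type (h0 : pairDist E.initialPair ∈ E.feasiblePolicy floor ceil)
    (P : S → StudentPref C) (s : S) :
    (E.ttcAssignment (E.combinedPolicy floor ceil) master (fun s => H.pref s (P s)) s).2 =
      E.type s := by
  by_contra hne
  rcases ttcAssignment_eq_or_rel (master := master) (Q := fun s => H.pref s (P s)) h0 s with h | h
  · exact hne (by rw [h]; rfl)
  · exact (H.pref s (P s)).asymm h (H.other_type s (P s) _ _ hne)

theorem ttcAssignment_eq (h0 : pairDist E.initialPair ∈ E.feasiblePolicy floor ceil)
    (P : S → StudentPref C) (s : S) :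
    E.ttcAssignment (E.combinedPolicy floor ceil) master (fun s => H.pref s (P s)) s =
      ((E.ttcAssignment (E.combinedPolicy floor ceil) master (fun s => H.pref s (P s)) s).1,
        E.type s) :=
  Prod.ext rfl (ttcAssignment_type h0 P s)

theorem feasible_and_satisfies_ttc
    (h0 : pairDist E.initialPair ∈ E.feasiblePolicy floor ceil) (P : S → StudentPref C) :
    Feasible E.capacity (E.ttc (E.combinedPolicy floor ceil) master H P) ∧
      E.Satisfies (E.combinedPolicy floor ceil)
        (E.ttc (E.combinedPolicy floor ceil) master H P) := by
  rw [ttc_eq_graphMatching, feasible_and_satisfies_iff]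
  simp_rw [← ttcAssignment_eq h0]
  exact pairDist_ttcAssignment_mem h0

theorem not_paretoDominates_ttc (h0 : pairDist E.initialPair ∈ E.feasiblePolicy floor ceil)
    (P : S → StudentPref C) {Y : Matching S C} (hY : Feasible E.capacity Y)
    (hYG : E.Satisfies (E.combinedPolicy floor ceil) Y) :
    ¬ ParetoDominates P Y (E.ttc (E.combinedPolicy floor ceil) master H P) := by
  rintro ⟨hweak, s, hs⟩
  simp only [ttc_eq_graphMatching, outcome_graphMatching] at hweak hs
  -- Being unmatched is the worst outcome, so the dominating matching matches every student.
  have hex : ∀ s, ∃ c, outcome Y s = some c := by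
    intro s
    rw [← Option.ne_none_iff_exists']
    intro hnone
    rcases hweak s with h | h
    · rw [hnone] at h
      exact (P s).asymm h ((P s).outside_least _)
    · rw [hnone] at h
      cases h
  choose f hf using hex
  obtain rfl := eq_graphMatching hY.1 fun s => mem_of_outcome_eq_some (hf s)
  simp only [outcome_graphMatching] at hweak hs
  have heq := eq_ttcAssignment_of_weak (master := master) (Q := fun s => H.pref s (P s)) h0
    (feasible_and_satisfies_iff.1 ⟨hY, hYG⟩) fun s => by
      rw [ttcAssignment_eq h0 P s]
      rcases hweak s with h | h
      · exact Or.inr ((H.own_type s (P s) _ _).2 h)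
      · exact Or.inl (by rw [Option.some.inj h])
  rw [← congrFun heq s] at hs
  exact (P s).irrefl _ hs

theorem ttc_weak_initial (h0 : pairDist E.initialPair ∈ E.feasiblePolicy floor ceil)
    (P : S → StudentPref C) (s : S) :
    (P s).weak (outcome (E.ttc (E.combinedPolicy floor ceil) master H P) s)
      (outcome E.initial s) := by
  rw [ttc_eq_graphMatching, initial_eq_graphMatching, outcome_graphMatching, outcome_graphMatching]
  rcases ttcAssignment_eq_or_rel (master := master) (Q := fun s => H.pref s (P s)) h0 s with h | h
  · exact Or.inr (congrArg some (congrArg Prod.fst h))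
  · rw [ttcAssignment_eq h0 P s] at h
    exact Or.inl ((H.own_type s (P s) _ _).1 h)

theorem strategyProof_ttc (h0 : pairDist E.initialPair ∈ E.feasiblePolicy floor ceil) :
    StrategyProof (E.ttc (E.combinedPolicy floor ceil) master H) := by
  intro P s P' hrel
  rw [ttc_eq_graphMatching, ttc_eq_graphMatching, outcome_graphMatching,
    outcome_graphMatching, ← H.own_type s (P s), ← ttcAssignment_eq h0, ← ttcAssignment_eq h0]
    at hrel
  refine not_rel_ttcAssignment (Q := fun s => H.pref s (P s)) h0 (fun b hb => ?_) hrel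
  simp only [Function.update_of_ne hb]

end Problem

end SchoolChoice

open SchoolChoice in
theorem corollary5 {S D C T : Type*} [Fintype S] [Fintype D] [Fintype C] [Fintype T]
    (E : Problem S D C T) (floor ceil : C → T → ℕ)
    (master : StrictOrder S) (H : E.HypotheticalPreferences) :
    MConvex (E.combinedPolicy floor ceil ∩ E.basePolicy) ∧
    (∃ (m n : ℕ) (A B : Set (Distribution (Fin m) (Fin n))),
      MConvex A ∧ MConvex B ∧ ¬ MConvex (A ∩ B)) ∧
    (E.Satisfies (E.combinedPolicy floor ceil) E.initial →
      E.TTCTerminates (E.combinedPolicy floor ceil) master H ∧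
      E.MechanismFeasible (E.ttc (E.combinedPolicy floor ceil) master H) ∧
      E.SatisfiesPolicy (E.combinedPolicy floor ceil)
        (E.ttc (E.combinedPolicy floor ceil) master H) ∧
      E.ConstrainedEfficient (E.combinedPolicy floor ceil)
        (E.ttc (E.combinedPolicy floor ceil) master H) ∧
      E.IndividuallyRational (E.ttc (E.combinedPolicy floor ceil) master H) ∧
      Problem.StrategyProof (E.ttc (E.combinedPolicy floor ceil) master H)) := by
  refine ⟨Problem.mConvex_feasiblePolicy, exists_mConvex_inter_not_mConvex, fun hsat => ?_⟩
  have h0 : Problem.pairDist E.initialPair ∈ E.feasiblePolicy floor ceil := by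
    have hfeas := E.initial_feasible
    rw [E.initial_eq_graphMatching] at hsat hfeas
    exact Problem.feasible_and_satisfies_iff.1 ⟨hfeas, hsat⟩
  have hboth := Problem.feasible_and_satisfies_ttc (master := master) (H := H) h0
  exact ⟨fun P => Problem.exists_students_eq_empty h0, fun P => (hboth P).1, fun P => (hboth P).2,
    fun P => ⟨(hboth P).1, (hboth P).2, fun ⟨_, hY, hYG, hdom⟩ =>
      Problem.not_paretoDominates_ttc h0 P hY hYG hdom⟩,
    Problem.ttc_weak_initial h0, Problem.strategyProof_ttc h0⟩
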